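/- Let $X_1,\dots,X_n$ be independent Bernoulli ($\{0,1\}$-valued) random variables with $\mathbb{E}(X_i)=p_i$, let $W=\sum_{i=1}^n X_i$ have distribution $P_W$, and let $\lambda=\mathbb{E}(W)=\sum_{i=1}^n p_i>0$. Let $\mathrm{Po}(\lambda)$ be the Poisson distribution with mean $\lambda$. For probability mass functions $P,Q$ on a countable set put $$d_{\mathrm H}(P,Q)=\Bigl(\tfrac12\sum_x\bigl(\sqrt{P(x)}-\sqrt{Q(x)}\bigr)^2\Bigr)^{1/2},\qquad \mathrm{BC}(P,Q)=\sum_x\sqrt{P(x)Q(x)} .$$ For $\alpha_1,\alpha_2\in\mathbb{R}$ and $\theta>0$, with $x_+=\max\{x,0\}$, let $$h_\lambda(\alpha_1,\alpha_2,\theta)=\frac{3\lambda+(2-\alpha_2+\lambda)^3-(1-\alpha_2+\lambda)^3+|\alpha_1-\alpha_2|\,(2\lambda+|3-2\alpha_2|)\exp\Bigl(-\frac{((1-\alpha_2)_+)^2}{\theta\lambda}\Bigr)}{\theta\lambda},$$ $$g_\lambda(\alpha_1,\alpha_2,\theta)=\max\left\{\left|\Bigl(1+\sqrt{\tfrac{2}{\theta\lambda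 e}}\,|\alpha_1-\alpha_2|\Bigr)\lambda+\max_i x(u_i)\right|,\ \left|\Bigl(2e^{-3/2}+\sqrt{\tfrac{2}{\theta\lambda e}}\,|\alpha_1-\alpha_2|\Bigr)\lambda-\min_i x(u_i)\right|\right\},$$ where $x(u)=(c_0+c_1u+c_2u^2)e^{-u^2}$, the $u_i$ are the real zeros of $2c_2u^3+2c_1u^2-2(c_2-c_0)u-c_1$, and $c_0=(\alpha_2-\alpha_1)(\lambda-\alpha_2)$, $c_1=\sqrt{\theta\lambda}\,(\lambda+\alpha_1-2\alpha_2)$, $c_2=-\theta\lambda$. Let $$K_1(\lambda)=\sup\left\{\frac{1-h_\lambda(\alpha_1,\alpha_2,\theta)}{2\,g_\lambda(\alpha_1,\alpha_2,\theta)}:\ \alpha_1,\alpha_2\in\mathbb{R},\ \alpha_2\le\lambda+\tfrac32,\ \theta>0\right\}.$$ Then this supremum is finite, and $$\sqrt{1-\sqrt{1-K_1(\lambda)^2\Bigl(\sum_{i=1}^n p_i^2\Bigr)^2}}\ \le\ d_{\mathrm H}(P_W,\mathrm{Po}(\lambda)),\qquad \mathrm{BC}(P_W,\mathrm{Po}(\lambda))\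 \le\ \sqrt{1-K_1(\lambda)^2\Bigl(\sum_{i=1}^n p_i^2\Bigr)^2}.$$ Moreover, if $p_i<1$ for all $i$, then $$d_{\mathrm H}(P_W,\mathrm{Po}(\lambda))\ \le\ \sqrt{1-\exp\Bigl(-\frac1{2\lambda}\sum_{i=1}^n\frac{p_i^3}{1-p_i}\Bigr)},\qquad \exp\Bigl(-\frac1{2\lambda}\sum_{i=1}^n\frac{p_i^3}{1-p_i}\Bigr)\ \le\ \mathrm{BC}(P_W,\mathrm{Po}(\lambda)).$$ -/

import Mathlib

open MeasureTheory ProbabilityTheory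
open scoped NNReal

/-- The Hellinger distance between two probability measures on a countable set
(with measurable points), in terms of their probability mass functions:
`d_H(P, Q) = (1/2 * ∑ₓ (√P(x) - √Q(x))²)^(1/2)`. -/
noncomputable def hellingerDist {α : Type*} [MeasurableSpace α] (P Q : Measure α) : ℝ :=
  Real.sqrt (1 / 2 * ∑' x : α, (Real.sqrt (P.real {x}) - Real.sqrt (Q.real {x})) ^ 2)

/-- The Bhattacharyya parameter between two probability measures on a countable set
(with measurable points): `BC(P, Q) = ∑ₓ √(P(x) Q(x))`. -/
noncomputable def bhattacharyya {α : Type*} [MeasurableSpace α] (P Q : Measure α) : ℝ :=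
  ∑' x : α, Real.sqrt (P.real {x} * Q.real {x})

/-- The coefficient `c₀ = (α₂ - α₁)(l - α₂)`. -/
def coeff0 (l α₁ α₂ : ℝ) : ℝ := (α₂ - α₁) * (l - α₂)

/-- The coefficient `c₁ = √(θ l) (l + α₁ - 2 α₂)`. -/
noncomputable def coeff1 (l α₁ α₂ θ : ℝ) : ℝ := Real.sqrt (θ * l) * (l + α₁ - 2 * α₂)

/-- The coefficient `c₂ = -θ l`. -/
def coeff2 (l θ : ℝ) : ℝ := -(θ * l)

/-- The function `x(u) = (c₀ + c₁ u + c₂ u²) exp(-u²)`. -/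
noncomputable def xFun (l α₁ α₂ θ u : ℝ) : ℝ :=
  (coeff0 l α₁ α₂ + coeff1 l α₁ α₂ θ * u + coeff2 l θ * u ^ 2) * Real.exp (-u ^ 2)

/-- The set `{uᵢ}` of real zeros of the cubic
`2 c₂ u³ + 2 c₁ u² - 2 (c₂ - c₀) u - c₁`. -/
def cubicZeros (l α₁ α₂ θ : ℝ) : Set ℝ :=
  {u : ℝ | 2 * coeff2 l θ * u ^ 3 + 2 * coeff1 l α₁ α₂ θ * u ^ 2
      - 2 * (coeff2 l θ - coeff0 l α₁ α₂) * u - coeff1 l α₁ α₂ θ = 0}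

/-- `max {x(uᵢ)}` over the zeros of the cubic. For `l, θ > 0` the cubic has leading coefficient
`-2 θ l ≠ 0`, so the set of its real zeros is finite and nonempty and `sSup` is the maximum. -/
noncomputable def maxX (l α₁ α₂ θ : ℝ) : ℝ := sSup (xFun l α₁ α₂ θ '' cubicZeros l α₁ α₂ θ)

/-- `min {x(uᵢ)}` over the zeros of the cubic (see `maxX`). -/
noncomputable def minX (l α₁ α₂ θ : ℝ) : ℝ := sInf (xFun l α₁ α₂ θ '' cubicZeros l α₁ α₂ θ)

/-- The function `h_l(α₁, α₂, θ)`. -/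
noncomputable def hFun (l α₁ α₂ θ : ℝ) : ℝ :=
  (3 * l + (2 - α₂ + l) ^ 3 - (1 - α₂ + l) ^ 3
    + |α₁ - α₂| * (2 * l + |3 - 2 * α₂|) * Real.exp (-(max (1 - α₂) 0) ^ 2 / (θ * l))) / (θ * l)

/-- The function `g_l(α₁, α₂, θ)`. -/
noncomputable def gFun (l α₁ α₂ θ : ℝ) : ℝ :=
  max
    |(1 + Real.sqrt (2 / (θ * l * Real.exp 1)) * |α₁ - α₂|) * l + maxX l α₁ α₂ θ|
    |(2 * Real.exp (-(3 / 2)) + Real.sqrt (2 / (θ * l * Real.exp 1)) * |α₁ - α₂|) * l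
      - minX l α₁ α₂ θ|

/-- The set of values `(1 - h_l(α₁, α₂, θ)) / (2 g_l(α₁, α₂, θ))` over
`α₁, α₂ ∈ ℝ` with `α₂ ≤ l + 3/2`, and `θ > 0`. -/
def K1Values (l : ℝ) : Set ℝ :=
  {r : ℝ | ∃ α₁ α₂ θ : ℝ, α₂ ≤ l + 3 / 2 ∧ 0 < θ ∧
    r = (1 - hFun l α₁ α₂ θ) / (2 * gFun l α₁ α₂ θ)}

/-- The constant `K₁(l)`, the supremum of `K1Values l`. -/
noncomputable def K1 (l : ℝ) : ℝ := sSup (K1Values l)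

/-! Write `P` for the law of `W`, `Q` for the Poisson law, and `S = ∑ pᵢ²`. Both laws have mass one,
so `d_H² = 1 - BC`, and each Hellinger bound is the corresponding bound on `BC`.

Upper bound on `BC`: Cauchy–Schwarz gives `TV² ≤ 1 - BC²`, so it suffices that `r S ≤ TV` for every
`r` in `K1Values l`. This is Stein's method with `f(u) = (u - α₁) exp(-(u - α₂)²/(θl))`. The mean of
`l f(k+1) - k f(k)` is zero under `Q`, and under `P` it is `∑ pᵢ² E[f(Wᵢ+2) - f(Wᵢ+1)]` with `Wᵢ = W
- Xᵢ`. A pointwise quadratic minorant of the increment and the first two moments of `Wᵢ` bound this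
below by `(1 - h) S` (`one_sub_hFun_le_polyExp`). The function itself is at most `g` in absolute
value (`abs_stein_operator_le`), so the mean is at most `2 g TV`. Finiteness of the supremum is a
by-product: every value is at most `TV / S`.

Lower bound on `BC`: Jensen gives `BC ≥ exp(-D/2)`, where `D` is the relative entropy of `P` with
respect to `Q`. The modified log-Sobolev inequality `Ent(f) ≤ l E[(Δf)²/f]`, applied to `f = P/Q`,
gives `D ≤ (1/l) ∑ Tₖ²/Pₖ` with `Tₖ = (k+1)Pₖ₊₁ - l Pₖ`. This Fisher-type information is subadditive
over independent summands, and one Bernoulli variable contributes `p³/(1-p)`. -/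

/-! ### Generating polynomial, moments and size-biasing of Bernoulli sums. -/

section PoissonBinomial

open Polynomial

/-- The generating polynomial `∏ (1 - pᵢ + pᵢ X)` of a sum of independent Bernoulli variables. -/
noncomputable def pbPoly {ι : Type*} (s : Finset ι) (p : ι → ℝ) : ℝ[X] :=
  ∏ i ∈ s, (C (1 - p i) + C (p i) * X)

/-- The expectation `∑ₖ F(k) qₖ` of `F` under the weights given by the coefficients of `q`. -/
noncomputable def polyExp (F : ℕ → ℝ) : ℝ[X] →ₗ[ℝ] ℝ :=
  Polynomial.lsum fun k => F k • LinearMap.id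

lemma polyExp_monomial (F : ℕ → ℝ) (k : ℕ) (a : ℝ) : polyExp F (monomial k a) = F k * a := by
  simp [polyExp, Polynomial.lsum_apply, Polynomial.sum_monomial_index]

lemma polyExp_eq_sum_range (F : ℕ → ℝ) (q : ℝ[X]) {N : ℕ} (h : q.natDegree < N) :
    polyExp F q = ∑ k ∈ Finset.range N, F k * q.coeff k := by
  rw [polyExp, Polynomial.lsum_apply, Polynomial.sum_over_range' _ (by simp) _ h]
  simp

lemma hasSum_polyExp (F : ℕ → ℝ) (q : ℝ[X]) : HasSum (fun k => F k * q.coeff k) (polyExp F q) := by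
  rw [polyExp_eq_sum_range F q (Nat.lt_succ_self _)]
  refine hasSum_sum_of_ne_finset_zero fun k hk => ?_
  rw [coeff_eq_zero_of_natDegree_lt (by simpa using hk), mul_zero]

lemma polyExp_X_mul (F : ℕ → ℝ) (q : ℝ[X]) :
    polyExp F (X * q) = polyExp (fun k => F (k + 1)) q := by
  induction q using Polynomial.induction_on' with
  | add p q hp hq => rw [mul_add, map_add, map_add, hp, hq]
  | monomial n a => rw [X_mul_monomial, polyExp_monomial, polyExp_monomial]

lemma polyExp_derivative (F : ℕ → ℝ) (q : ℝ[X]) :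
    polyExp F (derivative q) = polyExp (fun k => k * F (k - 1)) q := by
  induction q using Polynomial.induction_on' with
  | add p q hp hq => rw [map_add, map_add, map_add, hp, hq]
  | monomial n a => rw [derivative_monomial, polyExp_monomial, polyExp_monomial]; ring

lemma polyExp_add (F G : ℕ → ℝ) (q : ℝ[X]) :
    polyExp (fun k => F k + G k) q = polyExp F q + polyExp G q := by
  simp only [polyExp_eq_sum_range _ q (Nat.lt_succ_self _), add_mul, Finset.sum_add_distrib]

lemma polyExp_sub (F G : ℕ → ℝ) (q : ℝ[X]) :
    polyExp (fun k => F k - G k) q = polyExp F q - polyExp G q := by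
  simp only [polyExp_eq_sum_range _ q (Nat.lt_succ_self _), sub_mul, Finset.sum_sub_distrib]

lemma polyExp_const_mul (c : ℝ) (F : ℕ → ℝ) (q : ℝ[X]) :
    polyExp (fun k => c * F k) q = c * polyExp F q := by
  simp only [polyExp_eq_sum_range _ q (Nat.lt_succ_self _), mul_assoc, Finset.mul_sum]

lemma polyExp_const (c : ℝ) (q : ℝ[X]) : polyExp (fun _ => c) q = c * q.eval 1 := by
  simp [polyExp_eq_sum_range _ q (Nat.lt_succ_self _), eval_eq_sum_range, Finset.mul_sum]

lemma polyExp_mono {F G : ℕ → ℝ} {q : ℝ[X]} (hq : ∀ k, 0 ≤ q.coeff k) (h : ∀ k, F k ≤ G k) :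
    polyExp F q ≤ polyExp G q := by
  simp only [polyExp_eq_sum_range _ q (Nat.lt_succ_self _)]
  exact Finset.sum_le_sum fun k _ => mul_le_mul_of_nonneg_right (h k) (hq k)

variable {ι : Type*} [DecidableEq ι]

lemma pbPoly_insert {s : Finset ι} {a : ι} (p : ι → ℝ) (ha : a ∉ s) :
    pbPoly (insert a s) p = (C (1 - p a) + C (p a) * X) * pbPoly s p :=
  Finset.prod_insert ha

lemma pbPoly_eq_mul_erase {s : Finset ι} {a : ι} (p : ι → ℝ) (ha : a ∈ s) :
    pbPoly s p = (C (1 - p a) + C (p a) * X) * pbPoly (s.erase a) p :=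
  (Finset.mul_prod_erase s _ ha).symm

omit [DecidableEq ι] in
lemma pbPoly_eval_one (s : Finset ι) (p : ι → ℝ) : (pbPoly s p).eval 1 = 1 := by
  simp [pbPoly, eval_prod]

omit [DecidableEq ι] in
lemma pbPoly_natDegree_le (s : Finset ι) (p : ι → ℝ) : (pbPoly s p).natDegree ≤ s.card := by
  refine (natDegree_prod_le _ _).trans ?_
  rw [Finset.card_eq_sum_ones]
  refine Finset.sum_le_sum fun i _ => ?_
  rw [add_comm]
  exact natDegree_linear_le

lemma coeff_linear_mul_zero (a b : ℝ) (q : ℝ[X]) :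
    ((C a + C b * X) * q).coeff 0 = a * q.coeff 0 := by
  simp [add_mul, mul_assoc]

lemma coeff_linear_mul_succ (a b : ℝ) (q : ℝ[X]) (k : ℕ) :
    ((C a + C b * X) * q).coeff (k + 1) = a * q.coeff (k + 1) + b * q.coeff k := by
  simp [add_mul, mul_assoc, coeff_X_mul]

lemma pbPoly_coeff_nonneg (s : Finset ι) {p : ι → ℝ} (h0 : ∀ i, 0 ≤ p i) (h1 : ∀ i, p i ≤ 1)
    (k : ℕ) : 0 ≤ (pbPoly s p).coeff k := by
  induction s using Finset.induction_on generalizing k with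
  | empty => simp only [pbPoly, Finset.prod_empty, coeff_one]; positivity
  | insert a s ha ih =>
    rw [pbPoly_insert p ha]
    have := sub_nonneg.2 (h1 a)
    cases k with
    | zero => rw [coeff_linear_mul_zero]; exact mul_nonneg this (ih 0)
    | succ k =>
      rw [coeff_linear_mul_succ]
      exact add_nonneg (mul_nonneg this (ih _)) (mul_nonneg (h0 a) (ih _))

lemma derivative_pbPoly (s : Finset ι) (p : ι → ℝ) :
    derivative (pbPoly s p) = ∑ i ∈ s, C (p i) * pbPoly (s.erase i) p := by
  rw [pbPoly, derivative_prod_finset]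
  refine Finset.sum_congr rfl fun i _ => ?_
  rw [mul_comm, pbPoly]
  simp

/-- Size-biasing: `E[W F(W - 1)] = ∑ pᵢ E[F(W - Xᵢ)]`. -/
lemma polyExp_mul_pred (F : ℕ → ℝ) (s : Finset ι) (p : ι → ℝ) :
    polyExp (fun k => k * F (k - 1)) (pbPoly s p)
      = ∑ i ∈ s, p i * polyExp F (pbPoly (s.erase i) p) := by
  rw [← polyExp_derivative, derivative_pbPoly, map_sum]
  simp [← smul_eq_C_mul]

/-- Condition on the value of `Xᵢ`, which is independent of the remaining sum. -/
lemma polyExp_erase (F : ℕ → ℝ) {s : Finset ι} {i : ι} (p : ι → ℝ) (hi : i ∈ s) :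
    polyExp F (pbPoly s p) = polyExp F (pbPoly (s.erase i) p)
      + p i * polyExp (fun k => F (k + 1) - F k) (pbPoly (s.erase i) p) := by
  rw [pbPoly_eq_mul_erase p hi, polyExp_sub, ← polyExp_X_mul, add_mul, mul_assoc, map_add,
    ← smul_eq_C_mul, ← smul_eq_C_mul, map_smul, map_smul]
  simp only [smul_eq_mul]
  ring

/-- The Chen–Stein identity for sums of independent Bernoulli variables. -/
lemma polyExp_chenStein (f : ℕ → ℝ) (s : Finset ι) (p : ι → ℝ) :
    polyExp (fun k => (∑ i ∈ s, p i) * f (k + 1) - k * f k) (pbPoly s p)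
      = ∑ i ∈ s, p i ^ 2 * polyExp (fun k => f (k + 2) - f (k + 1)) (pbPoly (s.erase i) p) := by
  have h : (fun k : ℕ => (k : ℝ) * f k) = fun k : ℕ => (k : ℝ) * (fun j => f (j + 1)) (k - 1) := by
    funext k
    cases k <;> simp
  rw [polyExp_sub, polyExp_const_mul, h, polyExp_mul_pred (fun j => f (j + 1)), Finset.sum_mul,
    ← Finset.sum_sub_distrib]
  refine Finset.sum_congr rfl fun i hi => ?_
  rw [polyExp_erase (fun j => f (j + 1)) p hi]
  ring

lemma polyExp_id (s : Finset ι) (p : ι → ℝ) :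
    polyExp (fun k => (k : ℝ)) (pbPoly s p) = ∑ i ∈ s, p i := by
  have := polyExp_mul_pred (fun _ => 1) s p
  simpa [polyExp_const, pbPoly_eval_one] using this

lemma polyExp_sq (s : Finset ι) (p : ι → ℝ) :
    polyExp (fun k => (k : ℝ) ^ 2) (pbPoly s p)
      = (∑ i ∈ s, p i) ^ 2 + ∑ i ∈ s, p i - ∑ i ∈ s, p i ^ 2 := by
  have h : (fun k : ℕ => (k : ℝ) ^ 2) = fun k : ℕ => (k : ℝ) * (fun j : ℕ => (j : ℝ) + 1) (k - 1) := by
    funext k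
    cases k <;> simp [sq]
  rw [h, polyExp_mul_pred (fun j : ℕ => (j : ℝ) + 1), sq (∑ i ∈ s, p i), Finset.sum_mul, ← Finset.sum_add_distrib,
    ← Finset.sum_sub_distrib]
  refine Finset.sum_congr rfl fun i hi => ?_
  rw [polyExp_add, polyExp_id, polyExp_const, pbPoly_eval_one, ← Finset.add_sum_erase s p hi]
  ring

/-- The law of a sum of independent Bernoulli variables. -/
lemma measureReal_sum_eq_coeff_pbPoly {Ω : Type*} [MeasurableSpace Ω] {μ : Measure Ω}
    [IsProbabilityMeasure μ] {X : ι → Ω → ℕ} {p : ι → ℝ} (hmeas : ∀ i, Measurable (X i))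
    (hindep : iIndepFun X μ) (h0 : ∀ i, μ.real {ω | X i ω = 0} = 1 - p i)
    (h1 : ∀ i, μ.real {ω | X i ω = 1} = p i) (hX : ∀ i, ∀ᵐ ω ∂μ, X i ω = 0 ∨ X i ω = 1)
    (s : Finset ι) (k : ℕ) :
    μ.real {ω | ∑ i ∈ s, X i ω = k} = (pbPoly s p).coeff k := by
  induction s using Finset.induction_on generalizing k with
  | empty =>
    by_cases hk : k = 0
    · simp [pbPoly, hk]
    · simp [pbPoly, coeff_one, hk, Ne.symm hk]
  | insert a s ha ih =>
    have hind : IndepFun (∑ j ∈ s, X j) (X a) μ := hindep.indepFun_finsetSum_of_notMem hmeas ha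
    have hprod : ∀ i j : ℕ, μ.real {ω | ∑ j ∈ s, X j ω = i ∧ X a ω = j}
        = (pbPoly s p).coeff i * μ.real {ω | X a ω = j} := by
      intro i j
      have := hind.measure_inter_preimage_eq_mul {i} {j} (measurableSet_singleton _)
        (measurableSet_singleton _)
      rw [← ih i, measureReal_def, measureReal_def, measureReal_def, ← ENNReal.toReal_mul]
      congr 1
      convert this using 2
      · ext ω; simp
      · congr 1; ext ω; simp
      · rfl
    have hms : ∀ i j : ℕ, MeasurableSet {ω | ∑ j ∈ s, X j ω = i ∧ X a ω = j} := fun i j =>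
      (measurableSet_eq_fun (Finset.measurable_fun_sum s fun i _ => hmeas i) measurable_const).inter
        (measurableSet_eq_fun (hmeas a) measurable_const)
    rw [pbPoly_insert p ha]
    cases k with
    | zero =>
      rw [coeff_linear_mul_zero, mul_comm, ← h0 a, ← hprod]
      congr 1; ext ω
      simp [Finset.sum_insert ha, and_comm]
    | succ k =>
      rw [coeff_linear_mul_succ, mul_comm, ← h0 a, ← hprod, mul_comm (p a), ← h1 a, ← hprod,
        ← measureReal_union _ (hms _ _)]
      · refine measureReal_congr ?_
        filter_upwards [hX a] with ω hω
        apply propext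
        change (∑ i ∈ insert a s, X i ω = k + 1) ↔
          (∑ j ∈ s, X j ω = k + 1 ∧ X a ω = 0) ∨ (∑ j ∈ s, X j ω = k ∧ X a ω = 1)
        rw [Finset.sum_insert ha]
        omega
      · refine Set.disjoint_left.2 fun ω h h' => ?_
        have := h.2.symm.trans h'.2
        omega

end PoissonBinomial

/-! ### Subadditivity of the scaled Fisher information. -/

/-- The function `(x, a) ↦ x² / a` is subadditive. -/
lemma sq_add_div_add_le {x y a b : ℝ} (ha : 0 ≤ a) (hb : 0 ≤ b) (hx : a = 0 → x = 0)
    (hy : b = 0 → y = 0) : (x + y) ^ 2 / (a + b) ≤ x ^ 2 / a + y ^ 2 / b := by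
  rcases ha.eq_or_lt with rfl | ha
  · simp [hx rfl]
  rcases hb.eq_or_lt with rfl | hb
  · simp [hy rfl]
  rw [div_add_div _ _ ha.ne' hb.ne', div_le_div_iff₀ (by positivity) (by positivity)]
  nlinarith [sq_nonneg (x * b - y * a), mul_pos ha hb]

lemma mul_sq_div_mul (c x a : ℝ) : (c * x) ^ 2 / (c * a) = c * (x ^ 2 / a) := by
  rcases eq_or_ne c 0 with rfl | hc
  · simp
  · rw [mul_pow, sq c, mul_assoc, mul_div_mul_left _ _ hc, mul_div_assoc]

section ChiSquare

open Polynomial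

variable {ι : Type*} [DecidableEq ι]

/-- The polynomial `∑ pᵢ (Qᵢ - P)`, where `P` generates the law of `∑ Xᵢ` and `Qᵢ` that of the
sum without `Xᵢ`. -/
noncomputable def sizeBiasDefect (s : Finset ι) (p : ι → ℝ) : ℝ[X] :=
  ∑ i ∈ s, C (p i) * (pbPoly (s.erase i) p - pbPoly s p)

lemma sizeBiasDefect_insert {s : Finset ι} {a : ι} (p : ι → ℝ) (ha : a ∉ s) :
    sizeBiasDefect (insert a s) p = (C (1 - p a) + C (p a) * X) * sizeBiasDefect s p
      + C (p a) * (pbPoly s p - (C (1 - p a) + C (p a) * X) * pbPoly s p) := by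
  rw [sizeBiasDefect, Finset.sum_insert ha, Finset.erase_insert ha, add_comm, sizeBiasDefect,
    Finset.mul_sum, pbPoly_insert p ha]
  congr 1
  refine Finset.sum_congr rfl fun i hi => ?_
  rw [Finset.erase_insert_of_ne (by rintro rfl; exact ha hi),
    pbPoly_insert p (fun h => ha (Finset.mem_of_mem_erase h))]
  ring

/-- The defect equals `P' - (∑ pᵢ) P`, so its coefficients measure the failure of the Poisson
recursion `(k+1) Pₖ₊₁ = l Pₖ`. -/
lemma coeff_sizeBiasDefect (s : Finset ι) (p : ι → ℝ) (k : ℕ) :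
    (sizeBiasDefect s p).coeff k
      = (k + 1) * (pbPoly s p).coeff (k + 1) - (∑ i ∈ s, p i) * (pbPoly s p).coeff k := by
  have h : sizeBiasDefect s p = derivative (pbPoly s p) - C (∑ i ∈ s, p i) * pbPoly s p := by
    rw [derivative_pbPoly, sizeBiasDefect, map_sum, Finset.sum_mul, ← Finset.sum_sub_distrib]
    simp only [mul_sub]
  rw [h, coeff_sub, coeff_derivative, coeff_C_mul, mul_comm]

lemma coeff_sizeBiasDefect_insert_zero {s : Finset ι} {a : ι} (p : ι → ℝ) (ha : a ∉ s) :
    (sizeBiasDefect (insert a s) p).coeff 0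
      = (1 - p a) * (sizeBiasDefect s p).coeff 0 + p a ^ 2 * (pbPoly s p).coeff 0 := by
  rw [sizeBiasDefect_insert p ha, coeff_add, coeff_C_mul, coeff_sub, coeff_linear_mul_zero,
    coeff_linear_mul_zero]
  ring

lemma coeff_sizeBiasDefect_insert_succ {s : Finset ι} {a : ι} (p : ι → ℝ) (ha : a ∉ s) (k : ℕ) :
    (sizeBiasDefect (insert a s) p).coeff (k + 1)
      = ((1 - p a) * (sizeBiasDefect s p).coeff (k + 1) + p a ^ 2 * (pbPoly s p).coeff (k + 1))
        + p a * ((sizeBiasDefect s p).coeff k - p a * (pbPoly s p).coeff k) := by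
  rw [sizeBiasDefect_insert p ha, coeff_add, coeff_C_mul, coeff_sub, coeff_linear_mul_succ,
    coeff_linear_mul_succ]
  ring

/-- Since `pᵢ < 1`, the sum without `Xᵢ` cannot charge a point that the full sum misses. Hence the
convention `x / 0 = 0` loses nothing in `∑ Tₖ² / Pₖ`. -/
lemma coeff_sizeBiasDefect_eq_zero (s : Finset ι) {p : ι → ℝ} (h0 : ∀ i, 0 ≤ p i)
    (h1 : ∀ i, p i < 1) (k : ℕ) (hk : (pbPoly s p).coeff k = 0) :
    (sizeBiasDefect s p).coeff k = 0 := by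
  rw [sizeBiasDefect, finsetSum_coeff]
  refine Finset.sum_eq_zero fun i hi => ?_
  have h : (pbPoly (s.erase i) p).coeff k = 0 := by
    have hQ := pbPoly_coeff_nonneg (s.erase i) h0 (fun i => (h1 i).le)
    have hi1 := sub_pos.2 (h1 i)
    have key := hk
    rw [pbPoly_eq_mul_erase p hi] at key
    cases k with
    | zero =>
      rw [coeff_linear_mul_zero] at key
      exact (mul_eq_zero.1 key).resolve_left hi1.ne'
    | succ k =>
      rw [coeff_linear_mul_succ] at key
      have := ((add_eq_zero_iff_of_nonneg (mul_nonneg hi1.le (hQ _))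
        (mul_nonneg (h0 i) (hQ _))).1 key).1
      exact (mul_eq_zero.1 this).resolve_left hi1.ne'
  rw [coeff_C_mul, coeff_sub, h, hk, sub_zero, mul_zero]

omit [DecidableEq ι] in
lemma sum_coeff_pbPoly (s : Finset ι) (p : ι → ℝ) {M : ℕ} (hM : s.card < M) :
    ∑ k ∈ Finset.range M, (pbPoly s p).coeff k = 1 := by
  have := eval_eq_sum_range' ((pbPoly_natDegree_le s p).trans_lt hM) 1
  simpa [pbPoly_eval_one] using this.symm

/-- Subadditivity of the scaled Fisher information of Bernoulli sums. -/
lemma sum_sizeBiasDefect_sq_div_le (s : Finset ι) {p : ι → ℝ} (h0 : ∀ i, 0 ≤ p i)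
    (h1 : ∀ i, p i < 1) {M : ℕ} (hM : s.card < M) :
    ∑ k ∈ Finset.range M, (sizeBiasDefect s p).coeff k ^ 2 / (pbPoly s p).coeff k
      ≤ ∑ i ∈ s, p i ^ 3 / (1 - p i) := by
  induction s using Finset.induction_on generalizing M with
  | empty => simp [sizeBiasDefect]
  | insert a s ha ih =>
    rw [Finset.card_insert_of_notMem ha] at hM
    obtain ⟨M, rfl⟩ : ∃ m, M = m + 1 := ⟨M - 1, by omega⟩
    replace hM : s.card < M := by omega
    have hP := pbPoly_coeff_nonneg s h0 (fun i => (h1 i).le)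
    have hT := coeff_sizeBiasDefect_eq_zero s h0 h1
    have hq : 0 < 1 - p a := sub_pos.2 (h1 a)
    set P := pbPoly s p with hPdef
    set T := sizeBiasDefect s p with hTdef
    set r := p a with hr
    have hr0 : 0 ≤ r := h0 a
    have expand : ∀ (c : ℝ) (k : ℕ), (T.coeff k + c * P.coeff k) ^ 2 / P.coeff k
        = T.coeff k ^ 2 / P.coeff k + 2 * c * T.coeff k + c ^ 2 * P.coeff k := by
      intro c k
      by_cases hk : P.coeff k = 0
      · simp [hk, hT k hk]
      · field_simp
        ring
    -- The numerator splits according to the new variable being 0 (`stay`) or 1 (`move`). The cross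
    -- terms `± 2 r² T` cancel when the two are added.
    have stay : ∀ k, ((1 - r) * T.coeff k + r ^ 2 * P.coeff k) ^ 2 / ((1 - r) * P.coeff k)
        = (1 - r) * (T.coeff k ^ 2 / P.coeff k) + 2 * r ^ 2 * T.coeff k
          + r ^ 4 / (1 - r) * P.coeff k := by
      intro k
      have : (1 - r) * T.coeff k + r ^ 2 * P.coeff k
          = (1 - r) * (T.coeff k + r ^ 2 / (1 - r) * P.coeff k) := by
        field_simp
      rw [this, mul_sq_div_mul, expand]
      field_simp
    have move : ∀ k, (r * (T.coeff k - r * P.coeff k)) ^ 2 / (r * P.coeff k)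
        = r * (T.coeff k ^ 2 / P.coeff k) - 2 * r ^ 2 * T.coeff k + r ^ 3 * P.coeff k := by
      intro k
      have := expand (-r) k
      rw [neg_mul, ← sub_eq_add_neg] at this
      rw [mul_sq_div_mul, this]
      ring
    have hPM : P.coeff M = 0 :=
      coeff_eq_zero_of_natDegree_lt ((pbPoly_natDegree_le s p).trans_lt hM)
    have bound : ∀ k, (sizeBiasDefect (insert a s) p).coeff (k + 1) ^ 2
          / (pbPoly (insert a s) p).coeff (k + 1)
        ≤ ((1 - r) * T.coeff (k + 1) + r ^ 2 * P.coeff (k + 1)) ^ 2 / ((1 - r) * P.coeff (k + 1))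
          + (r * (T.coeff k - r * P.coeff k)) ^ 2 / (r * P.coeff k) := by
      intro k
      rw [coeff_sizeBiasDefect_insert_succ p ha, pbPoly_insert p ha, coeff_linear_mul_succ]
      refine sq_add_div_add_le (mul_nonneg hq.le (hP _)) (mul_nonneg hr0 (hP _)) ?_ ?_
      · intro h
        have h := (mul_eq_zero.1 h).resolve_left hq.ne'
        rw [← hPdef, ← hTdef, h, hT _ h]; simp
      · intro h
        rcases mul_eq_zero.1 h with h | h
        · rw [← hr] at h ⊢; rw [h]; simp
        · rw [← hPdef, ← hTdef, h, hT _ h]; simp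
    rw [Finset.sum_range_succ', Finset.sum_insert ha]
    calc _ ≤ ∑ k ∈ Finset.range M,
            (((1 - r) * T.coeff (k + 1) + r ^ 2 * P.coeff (k + 1)) ^ 2
                / ((1 - r) * P.coeff (k + 1))
              + (r * (T.coeff k - r * P.coeff k)) ^ 2 / (r * P.coeff k))
          + ((1 - r) * T.coeff 0 + r ^ 2 * P.coeff 0) ^ 2 / ((1 - r) * P.coeff 0) := by
          refine add_le_add (Finset.sum_le_sum fun k _ => bound k) (le_of_eq ?_)
          rw [coeff_sizeBiasDefect_insert_zero p ha, pbPoly_insert p ha, coeff_linear_mul_zero]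
      -- The separate term at 0 restores the first entry of the shifted `stay` sum; its last entry
      -- vanishes because `P.coeff M = 0`.
      _ = ∑ k ∈ Finset.range M,
            (((1 - r) * T.coeff k + r ^ 2 * P.coeff k) ^ 2 / ((1 - r) * P.coeff k)
              + (r * (T.coeff k - r * P.coeff k)) ^ 2 / (r * P.coeff k)) := by
          rw [Finset.sum_add_distrib, Finset.sum_add_distrib, add_right_comm,
            ← Finset.sum_range_succ' (fun k => ((1 - r) * T.coeff k + r ^ 2 * P.coeff k) ^ 2
                / ((1 - r) * P.coeff k)), Finset.sum_range_succ, hPM]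
          simp
      _ = ∑ k ∈ Finset.range M, (T.coeff k ^ 2 / P.coeff k + r ^ 3 / (1 - r) * P.coeff k) := by
          refine Finset.sum_congr rfl fun k _ => ?_
          rw [stay, move]
          have : r ^ 3 / (1 - r) = r ^ 4 / (1 - r) + r ^ 3 := by
            field_simp
            ring
          rw [this]
          ring
      _ ≤ r ^ 3 / (1 - r) + ∑ i ∈ s, p i ^ 3 / (1 - p i) := by
          rw [Finset.sum_add_distrib, ← Finset.mul_sum, sum_coeff_pbPoly s p hM, mul_one, add_comm]
          exact add_le_add le_rfl (ih hM)

end ChiSquare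

/-! ### Modified log-Sobolev inequality: Bernoulli, binomial, Poisson. -/

section ModifiedLogSobolev

open Filter Topology

/-- The averaging operator `f ↦ E[f(· + B)]` for a Bernoulli variable `B` with mean `q`. -/
noncomputable def bernAvg (q : ℝ) : Module.End ℝ (ℕ → ℝ) :=
  q • LinearMap.funLeft ℝ ℝ Nat.succ + (1 - q) • 1

lemma bernAvg_apply (q : ℝ) (f : ℕ → ℝ) (x : ℕ) :
    bernAvg q f x = q * f (x + 1) + (1 - q) * f x := by
  simp [bernAvg, LinearMap.funLeft_apply]

lemma bernAvg_pow_mono {q : ℝ} (h0 : 0 ≤ q) (h1 : q ≤ 1) (N : ℕ) {f g : ℕ → ℝ} (h : f ≤ g) :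
    (bernAvg q ^ N) f ≤ (bernAvg q ^ N) g := by
  induction N generalizing f g with
  | zero => exact h
  | succ N ih =>
    rw [pow_succ, Module.End.mul_apply, Module.End.mul_apply]
    refine ih fun x => ?_
    rw [bernAvg_apply, bernAvg_apply]
    exact add_le_add (mul_le_mul_of_nonneg_left (h _) h0)
      (mul_le_mul_of_nonneg_left (h _) (sub_nonneg.2 h1))

lemma bernAvg_pow_apply (q : ℝ) (N : ℕ) (f : ℕ → ℝ) (x : ℕ) :
    (bernAvg q ^ N) f x
      = ∑ k ∈ Finset.range (N + 1), N.choose k * q ^ k * (1 - q) ^ (N - k) * f (x + k) := by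
  have hS : ∀ k : ℕ, ((LinearMap.funLeft ℝ ℝ Nat.succ) ^ k) f = fun x => f (x + k) := by
    intro k
    induction k with
    | zero => rfl
    | succ k ih =>
      rw [pow_succ', Module.End.mul_apply, ih]
      funext x
      simp only [LinearMap.funLeft_apply]
      congr 1
      omega
  rw [bernAvg, Commute.add_pow (((Commute.one_right _).smul_right _).smul_left _)]
  simp only [LinearMap.sum_apply, Finset.sum_apply, smul_pow, one_pow]
  refine Finset.sum_congr rfl fun k _ => ?_
  rw [← nsmul_eq_mul']
  simp [hS]
  ring

/-- The energy density `(f(x+1) - f(x))² / f(x)` of the modified log-Sobolev inequality. -/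
noncomputable def chiEnergy (f : ℕ → ℝ) (x : ℕ) : ℝ := (f (x + 1) - f x) ^ 2 / f x

lemma mul_log_ge_tangent {m a : ℝ} (hm : 0 ≤ m) (ha : 0 < a) :
    m * Real.log a + m - a ≤ m * Real.log m := by
  rcases hm.eq_or_lt with rfl | hm
  · simp [ha.le]
  · have h := Real.log_le_sub_one_of_pos (div_pos ha hm)
    rw [Real.log_div ha.ne' hm.ne'] at h
    have h2 := mul_le_mul_of_nonneg_left h hm.le
    have : m * (a / m - 1) = a - m := by field_simp
    linarith

lemma mul_log_le_quadratic {b a : ℝ} (hb : 0 ≤ b) (ha : 0 < a) :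
    b * Real.log b ≤ b * Real.log a + b * (b / a - 1) := by
  rcases hb.eq_or_lt with rfl | hb
  · simp
  · have h := Real.log_le_sub_one_of_pos (div_pos hb ha)
    rw [Real.log_div hb.ne' ha.ne'] at h
    nlinarith

/-- Expand around `a`: bound `m log m` at the mean from below by its tangent, and `log b` from above
by `log a + b/a - 1`. What remains is exactly `q (b-a)²/a`. -/
lemma bernoulli_modified_logSobolev {q a b : ℝ} (h0 : 0 ≤ q) (h1 : q ≤ 1) (ha : 0 ≤ a)
    (hb : 0 ≤ b) (hab : a = 0 → b = 0) :
    q * (b * Real.log b) + (1 - q) * (a * Real.log a)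
      - (q * b + (1 - q) * a) * Real.log (q * b + (1 - q) * a) ≤ q * ((b - a) ^ 2 / a) := by
  rcases ha.eq_or_lt with rfl | ha
  · simp [hab rfl]
  · have hm : 0 ≤ q * b + (1 - q) * a :=
      add_nonneg (mul_nonneg h0 hb) (mul_nonneg (sub_nonneg.2 h1) ha.le)
    have e1 := mul_log_ge_tangent hm ha
    have e2 := mul_le_mul_of_nonneg_left (mul_log_le_quadratic hb ha) h0
    have e3 : (b - a) ^ 2 / a = b * (b / a - 1) - (b - a) := by
      field_simp
    rw [e3]
    linarith

/-- Tensorization by induction: entropy splits into one averaging step for `f` plus the remaining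
steps for `bernAvg q f`. Each step costs one `q` times an averaged energy. -/
lemma bernAvg_modified_logSobolev {q : ℝ} (h0 : 0 ≤ q) (h1 : q < 1) (N : ℕ) {f : ℕ → ℝ}
    (hf : ∀ x, 0 ≤ f x) (hz : ∀ x, f x = 0 → f (x + 1) = 0) (x : ℕ) :
    (bernAvg q ^ (N + 1)) (fun y => f y * Real.log (f y)) x
      - (bernAvg q ^ (N + 1)) f x * Real.log ((bernAvg q ^ (N + 1)) f x)
      ≤ (N + 1) * q * (bernAvg q ^ N) (chiEnergy f) x := by
  have hq : 0 < 1 - q := sub_pos.2 h1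
  have base : ∀ y, bernAvg q (fun y => f y * Real.log (f y)) y
      ≤ bernAvg q f y * Real.log (bernAvg q f y) + q * chiEnergy f y := by
    intro y
    simp only [bernAvg_apply]
    have := bernoulli_modified_logSobolev h0 h1.le (hf y) (hf (y + 1)) (hz y)
    rw [chiEnergy]
    linarith
  induction N generalizing f x with
  | zero =>
    have := base x
    simp only [zero_add, pow_one, pow_zero, Module.End.one_apply, Nat.cast_zero, one_mul]
    linarith
  | succ N ih =>
    have hg : ∀ x, 0 ≤ bernAvg q f x := fun x => by
      rw [bernAvg_apply]
      exact add_nonneg (mul_nonneg h0 (hf _)) (mul_nonneg hq.le (hf _))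
    have hgz : ∀ x, bernAvg q f x = 0 → bernAvg q f (x + 1) = 0 := fun x h => by
      rw [bernAvg_apply] at h
      have := ((add_eq_zero_iff_of_nonneg (mul_nonneg h0 (hf _)) (mul_nonneg hq.le (hf _))).1 h).2
      have hx := (mul_eq_zero.1 this).resolve_left hq.ne'
      rw [bernAvg_apply, hz _ (hz _ hx), hz _ hx]
      simp
    have base' : ∀ y, bernAvg q (fun y => bernAvg q f y * Real.log (bernAvg q f y)) y
        ≤ bernAvg q (bernAvg q f) y * Real.log (bernAvg q (bernAvg q f) y)
          + q * chiEnergy (bernAvg q f) y := by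
      intro y
      rw [bernAvg_apply q (fun y => bernAvg q f y * Real.log (bernAvg q f y)),
        bernAvg_apply q (bernAvg q f)]
      have := bernoulli_modified_logSobolev h0 h1.le (hg y) (hg (y + 1)) (hgz y)
      rw [chiEnergy]
      linarith
    -- Joint convexity of `x²/a`: averaging can only lower the energy.
    have conv : chiEnergy (bernAvg q f) ≤ bernAvg q (chiEnergy f) := by
      intro y
      rw [chiEnergy, bernAvg_apply q (chiEnergy f), bernAvg_apply, bernAvg_apply, chiEnergy,
        chiEnergy, ← mul_sq_div_mul, ← mul_sq_div_mul]
      have : q * f (y + 1 + 1) + (1 - q) * f (y + 1) - (q * f (y + 1) + (1 - q) * f y)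
          = q * (f (y + 1 + 1) - f (y + 1)) + (1 - q) * (f (y + 1) - f y) := by ring
      rw [this]
      refine sq_add_div_add_le (mul_nonneg h0 (hf _)) (mul_nonneg hq.le (hf _)) ?_ ?_
      · intro h
        rcases mul_eq_zero.1 h with h | h
        · simp [h]
        · rw [hz _ h, h]; simp
      · intro h
        have h := (mul_eq_zero.1 h).resolve_left hq.ne'
        rw [hz _ h, h]; simp
    have step := ih hg hgz x base'
    have e1 := bernAvg_pow_mono h0 h1.le (N + 1)
      (g := (fun y => bernAvg q f y * Real.log (bernAvg q f y)) + q • chiEnergy f) base x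
    rw [map_add, map_smul, Pi.add_apply, Pi.smul_apply, smul_eq_mul] at e1
    have e2 := bernAvg_pow_mono h0 h1.le N conv x
    rw [← Module.End.mul_apply, ← pow_succ] at e2
    rw [pow_succ _ (N + 1), Module.End.mul_apply, Module.End.mul_apply]
    have e3 := mul_le_mul_of_nonneg_left e2 (by positivity : (0 : ℝ) ≤ (N + 1) * q)
    push_cast
    linarith

lemma tendsto_bernAvg_pow {l : ℝ} {q : ℕ → ℝ} (hq : Tendsto (fun n => n * q n) atTop (𝓝 l))
    {F : ℕ → ℝ} {M : ℕ} (hF : ∀ k, M ≤ k → F k = 0) :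
    Tendsto (fun n => (bernAvg (q n) ^ n) F 0) atTop
      (𝓝 (∑ k ∈ Finset.range M, Real.exp (-l) * l ^ k / k.factorial * F k)) := by
  have h : Tendsto (fun n : ℕ => ∑ k ∈ Finset.range M,
      n.choose k * q n ^ k * (1 - q n) ^ (n - k) * F k) atTop
      (𝓝 (∑ k ∈ Finset.range M, Real.exp (-l) * l ^ k / k.factorial * F k)) :=
    tendsto_finsetSum _ fun k _ =>
      (tendsto_choose_mul_pow_of_tendsto_mul_atTop k hq).mul_const _
  refine h.congr' ?_
  filter_upwards [eventually_ge_atTop M] with n hn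
  rw [bernAvg_pow_apply]
  simp only [zero_add]
  refine Finset.sum_subset (Finset.range_subset_range.2 (by omega)) fun k _ hk => ?_
  rw [hF k (by simpa using hk), mul_zero]

/-- The modified log-Sobolev inequality for the Poisson distribution. -/
lemma poisson_modified_logSobolev {l : ℝ} (hl : 0 < l) {f : ℕ → ℝ} {M : ℕ}
    (hf : ∀ x, 0 ≤ f x) (hz : ∀ x, f x = 0 → f (x + 1) = 0) (hM : ∀ k, M ≤ k → f k = 0) :
    ∑ k ∈ Finset.range M, Real.exp (-l) * l ^ k / k.factorial * (f k * Real.log (f k))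
      - (∑ k ∈ Finset.range M, Real.exp (-l) * l ^ k / k.factorial * f k)
        * Real.log (∑ k ∈ Finset.range M, Real.exp (-l) * l ^ k / k.factorial * f k)
      ≤ l * ∑ k ∈ Finset.range M, Real.exp (-l) * l ^ k / k.factorial * chiEnergy f k := by
  have hq1 : Tendsto (fun n : ℕ => (n : ℝ) * (l / n)) atTop (𝓝 l) := by
    refine tendsto_const_nhds.congr' ?_
    filter_upwards [eventually_gt_atTop 0] with n hn
    field_simp
  -- With `n + 1` variables of mean `l/(n+1)`, the energy is averaged only `n` times, so its Poisson
  -- limit needs this separate rate.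
  have hq2 : Tendsto (fun n : ℕ => (n : ℝ) * (l / ((n + 1 : ℕ) : ℝ))) atTop (𝓝 l) := by
    have := (tendsto_natCast_div_add_atTop (1 : ℝ)).const_mul l
    rw [mul_one] at this
    refine this.congr fun n => ?_
    push_cast
    ring
  have t1 := (tendsto_add_atTop_iff_nat 1).2 (tendsto_bernAvg_pow hq1
    (F := fun k => f k * Real.log (f k)) (M := M) fun k hk => by simp [hM k hk])
  have t2 := (tendsto_add_atTop_iff_nat 1).2 (tendsto_bernAvg_pow hq1 hM)
  have t3 := tendsto_bernAvg_pow hq2 (F := chiEnergy f) (M := M)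
    fun k hk => by simp [chiEnergy, hM k hk]
  have t2' := (Real.continuous_mul_log.tendsto _).comp t2
  refine le_of_tendsto_of_tendsto (t1.sub t2') (t3.const_mul l) ?_
  filter_upwards [(tendsto_natCast_atTop_atTop (R := ℝ)).eventually_gt_atTop l] with n hn
  have hn1 : (0 : ℝ) < ((n + 1 : ℕ) : ℝ) := by positivity
  have := bernAvg_modified_logSobolev (q := l / ((n + 1 : ℕ) : ℝ)) (by positivity)
    (by rw [div_lt_one hn1]; push_cast; linarith) n hf hz 0
  have e : ((n : ℝ) + 1) * (l / ((n + 1 : ℕ) : ℝ)) = l := by push_cast; field_simp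
  rw [e] at this
  exact this

end ModifiedLogSobolev

/-! ### From relative entropy to the lower bound on `BC`. -/

/-- Jensen's inequality between the Bhattacharyya sum and the relative entropy. -/
lemma exp_neg_half_relEntropy_le {M : ℕ} {P Q : ℕ → ℝ} (hP : ∀ k, 0 ≤ P k) (hQ : ∀ k, 0 < Q k)
    (h1 : ∑ k ∈ Finset.range M, P k = 1) :
    Real.exp (-(1 / 2) * ∑ k ∈ Finset.range M, P k * Real.log (P k / Q k))
      ≤ ∑ k ∈ Finset.range M, Real.sqrt (P k * Q k) := by
  set m := -(1 / 2) * ∑ k ∈ Finset.range M, P k * Real.log (P k / Q k) with hm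
  -- Tangent line of `exp` at the mean `m` of `-(1/2) log (P/Q)` under `P`; the linear terms cancel
  -- on summation.
  have key : ∀ k, P k * Real.exp m
      + Real.exp m * (-(1 / 2) * (P k * Real.log (P k / Q k)) - m * P k)
      ≤ Real.sqrt (P k * Q k) := by
    intro k
    rcases (hP k).eq_or_lt with h | h
    · simp [← h]
    have e : Real.sqrt (P k * Q k) = P k * Real.exp (-(1 / 2) * Real.log (P k / Q k)) := by
      rw [Real.sqrt_eq_iff_mul_self_eq (by positivity [hQ k]) (by positivity),
        mul_mul_mul_comm, ← Real.exp_add]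
      have : -(1 / 2) * Real.log (P k / Q k) + -(1 / 2) * Real.log (P k / Q k)
          = -Real.log (P k / Q k) := by ring
      rw [this, Real.exp_neg, Real.exp_log (div_pos h (hQ k))]
      have := hQ k
      field_simp
    rw [e]
    have h2 := Real.add_one_le_exp (-(1 / 2) * Real.log (P k / Q k) - m)
    have h3 : Real.exp (-(1 / 2) * Real.log (P k / Q k))
        = Real.exp m * Real.exp (-(1 / 2) * Real.log (P k / Q k) - m) := by
      rw [← Real.exp_add]; congr 1; ring
    rw [h3]
    have h4 := mul_le_mul_of_nonneg_left h2 (mul_nonneg h.le (Real.exp_pos m).le)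
    nlinarith
  have hs := Finset.sum_le_sum fun k (_ : k ∈ Finset.range M) => key k
  rw [Finset.sum_add_distrib, ← Finset.sum_mul, h1, ← Finset.mul_sum, Finset.sum_sub_distrib,
    ← Finset.mul_sum, ← Finset.mul_sum, h1, ← hm] at hs
  simpa using hs

lemma pbPoly_bhattacharyya_ge {ι : Type*} [DecidableEq ι] (s : Finset ι) {p : ι → ℝ} {l : ℝ}
    (hl : 0 < l) (hsum : ∑ i ∈ s, p i = l) (h0 : ∀ i, 0 ≤ p i) (h1 : ∀ i, p i < 1) :
    Real.exp (-(1 / (2 * l)) * ∑ i ∈ s, p i ^ 3 / (1 - p i))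
      ≤ ∑ k ∈ Finset.range (s.card + 1),
        Real.sqrt ((pbPoly s p).coeff k * (Real.exp (-l) * l ^ k / k.factorial)) := by
  have hP := pbPoly_coeff_nonneg s h0 (fun i => (h1 i).le)
  have hQ : ∀ k : ℕ, 0 < Real.exp (-l) * l ^ k / k.factorial := fun k => by positivity
  have hsum1 := sum_coeff_pbPoly s p (Nat.lt_succ_self s.card)
  refine le_trans ?_ (exp_neg_half_relEntropy_le hP hQ hsum1)
  have hT := coeff_sizeBiasDefect_eq_zero s h0 h1
  have hco := coeff_sizeBiasDefect s p
  rw [hsum] at hco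
  have hM : ∀ k, s.card + 1 ≤ k → (pbPoly s p).coeff k = 0 := fun k hk =>
    Polynomial.coeff_eq_zero_of_natDegree_lt ((pbPoly_natDegree_le s p).trans_lt hk)
  have hsub := sum_sizeBiasDefect_sq_div_le s h0 h1 (Nat.lt_succ_self s.card)
  set P := fun k => (pbPoly s p).coeff k with hPdef
  set Q := fun k : ℕ => Real.exp (-l) * l ^ k / k.factorial with hQdef
  have hQs : ∀ k : ℕ, Q (k + 1) = Q k * l / (k + 1) := fun k => by
    simp only [hQdef, Nat.factorial_succ]
    push_cast
    field_simp
    ring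
  -- Where `P` vanishes, so does the defect, and its recursion forces the next coefficient to
  -- vanish.
  have hz : ∀ x, P x / Q x = 0 → P (x + 1) / Q (x + 1) = 0 := by
    intro x hx
    have hx := (div_eq_zero_iff.1 hx).resolve_right (hQ x).ne'
    have h := hco x
    rw [hT x hx] at h
    change 0 = _ * P (x + 1) - l * P x at h
    rw [hx, mul_zero, sub_zero, eq_comm] at h
    rw [(mul_eq_zero.1 h).resolve_left (by positivity), zero_div]
  have main := poisson_modified_logSobolev hl (f := fun k => P k / Q k) (M := s.card + 1)
    (fun k => div_nonneg (hP k) (hQ k).le) hz (fun k hk => by simp [hPdef, hM k hk])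
  have c1 : ∀ k, Q k * (P k / Q k) = P k := fun k => mul_div_cancel₀ _ (hQ k).ne'
  have c2 : ∀ k, Q k * (P k / Q k * Real.log (P k / Q k)) = P k * Real.log (P k / Q k) :=
    fun k => by rw [← mul_assoc, c1]
  have c3 : ∀ k, Q k * chiEnergy (fun k => P k / Q k) k
      = (1 / l) ^ 2 * ((sizeBiasDefect s p).coeff k ^ 2 / P k) := by
    intro k
    have hQk := (hQ k).ne'
    change Q k ≠ 0 at hQk
    rcases (hP k).eq_or_lt with h | h
    · have h : P k = 0 := h.symm
      simp [chiEnergy, h]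
    · have hPk : P k ≠ 0 := h.ne'
      rw [hco k, chiEnergy, hQs k]
      change _ = (1 / l) ^ 2 * (((k + 1) * P (k + 1) - l * P k) ^ 2 / P k)
      field_simp
  change ∑ k ∈ Finset.range (s.card + 1), Q k * (P k / Q k * Real.log (P k / Q k))
      - (∑ k ∈ Finset.range (s.card + 1), Q k * (P k / Q k))
        * Real.log (∑ k ∈ Finset.range (s.card + 1), Q k * (P k / Q k))
      ≤ l * ∑ k ∈ Finset.range (s.card + 1), Q k * chiEnergy (fun k => P k / Q k) k at main
  simp only [c1, c2, c3] at main
  rw [show ∑ k ∈ Finset.range (s.card + 1), P k = 1 from hsum1, ← Finset.mul_sum] at main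
  simp only [Real.log_one, mul_zero, sub_zero] at main
  refine Real.exp_le_exp.2 ?_
  have e : l * ((1 / l) ^ 2 * ∑ k ∈ Finset.range (s.card + 1),
      (sizeBiasDefect s p).coeff k ^ 2 / P k)
      = (1 / l) * ∑ k ∈ Finset.range (s.card + 1), (sizeBiasDefect s p).coeff k ^ 2 / P k := by
    field_simp
  rw [e] at main
  have h5 := mul_le_mul_of_nonneg_left hsub (by positivity : 0 ≤ 1 / l)
  have h6 : (1 / (2 * l)) = 1 / 2 * (1 / l) := by field_simp
  rw [h6]
  rw [neg_mul, neg_mul, mul_assoc]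
  exact neg_le_neg (mul_le_mul_of_nonneg_left (main.trans h5) (by norm_num))

/-! ### Hellinger distance, `BC` and total variation. -/

section Hellinger

lemma summable_sqrt_mul {P Q : ℕ → ℝ} (hP : ∀ k, 0 ≤ P k) (hQ : ∀ k, 0 ≤ Q k)
    (sP : HasSum P 1) (sQ : HasSum Q 1) : Summable fun k => Real.sqrt (P k * Q k) := by
  refine Summable.of_nonneg_of_le (fun k => Real.sqrt_nonneg _) (fun k => ?_)
    (sP.add sQ).summable
  rw [Real.sqrt_mul (hP k)]
  nlinarith [Real.sq_sqrt (hP k), Real.sq_sqrt (hQ k), sq_nonneg (√(P k) - √(Q k)), hP k, hQ k]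

lemma tsum_sqrt_sub_sqrt_sq {P Q : ℕ → ℝ} (hP : ∀ k, 0 ≤ P k) (hQ : ∀ k, 0 ≤ Q k)
    (sP : HasSum P 1) (sQ : HasSum Q 1) :
    1 / 2 * ∑' k, (Real.sqrt (P k) - Real.sqrt (Q k)) ^ 2
      = 1 - ∑' k, Real.sqrt (P k * Q k) := by
  have h := (sP.add sQ).sub ((summable_sqrt_mul hP hQ sP sQ).hasSum.mul_left 2)
  have e : (fun k => P k + Q k - 2 * Real.sqrt (P k * Q k))
      = fun k => (Real.sqrt (P k) - Real.sqrt (Q k)) ^ 2 := by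
    funext k
    rw [Real.sqrt_mul (hP k), sub_sq, Real.sq_sqrt (hP k), Real.sq_sqrt (hQ k)]
    ring
  rw [e] at h
  rw [h.tsum_eq]
  ring

lemma summable_abs_sub {P Q : ℕ → ℝ} (sP : HasSum P 1) (sQ : HasSum Q 1) :
    Summable fun k => |P k - Q k| :=
  (sP.sub sQ).summable.abs

/-- The squared total variation distance is at most `1 - BC²`. -/
lemma sq_tsum_abs_sub_le {P Q : ℕ → ℝ} (hP : ∀ k, 0 ≤ P k) (hQ : ∀ k, 0 ≤ Q k)
    (sP : HasSum P 1) (sQ : HasSum Q 1) :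
    (1 / 2 * ∑' k, |P k - Q k|) ^ 2 ≤ 1 - (∑' k, Real.sqrt (P k * Q k)) ^ 2 := by
  set B := ∑' k, Real.sqrt (P k * Q k) with hB
  set D := ∑' k, |P k - Q k| with hD
  have sB : HasSum (fun k => Real.sqrt (P k * Q k)) B := (summable_sqrt_mul hP hQ sP sQ).hasSum
  have sD : HasSum (fun k => |P k - Q k|) D := (summable_abs_sub sP sQ).hasSum
  -- The quadratic is `∑ (t|√P - √Q| - (√P + √Q))²`; its discriminant gives Cauchy–Schwarz.
  have key : ∀ t : ℝ, 0 ≤ (2 - 2 * B) * (t * t) + (-2 * D) * t + (2 + 2 * B) := by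
    intro t
    have h := ((((sP.add sQ).sub (sB.mul_left 2)).mul_right (t * t)).add
      ((sD.mul_left (-2)).mul_right t)).add ((sP.add sQ).add (sB.mul_left 2))
    have := h.nonneg fun k => ?_
    · linarith
    · have e : |P k - Q k|
          = |√(P k) - √(Q k)| * (√(P k) + √(Q k)) := by
        rw [← abs_of_nonneg (by positivity : 0 ≤ √(P k) + √(Q k)), ← abs_mul]
        congr 1
        nlinarith [Real.sq_sqrt (hP k), Real.sq_sqrt (hQ k)]
      rw [e, Real.sqrt_mul (hP k)]
      nlinarith [sq_nonneg (t * |√(P k) - √(Q k)| - (√(P k) + √(Q k))),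
        Real.sq_sqrt (hP k), Real.sq_sqrt (hQ k), sq_abs (√(P k) - √(Q k))]
  have := discrim_le_zero key
  rw [discrim] at this
  nlinarith

end Hellinger

/-! ### Increments of the Stein test function. -/

section SteinFunction

lemma one_sub_three_mul_le {y : ℝ} (hy : 0 ≤ y) : 1 - 3 * y ≤ (1 - 2 * y) * Real.exp (-y) := by
  have h1 : Real.exp (-y) ≤ 1 := Real.exp_le_one_iff.2 (by linarith)
  have h2 := Real.add_one_le_exp (-y)
  rcases le_total y (1 / 2) with h | h <;> nlinarith

lemma one_sub_two_mul_exp_le {y : ℝ} (hy : 0 ≤ y) : (1 - 2 * y) * Real.exp (-y) ≤ 1 := by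
  have h1 : Real.exp (-y) ≤ 1 := Real.exp_le_one_iff.2 (by linarith)
  nlinarith [Real.exp_pos (-y)]

/-- With `y = v²/t`, the right side is the derivative of `v exp(-v²/t)`. Its minimum is at `y =
3/2`, which is the source of this constant in `gFun`. -/
lemma neg_two_exp_le (y : ℝ) : -(2 * Real.exp (-(3 / 2))) ≤ (1 - 2 * y) * Real.exp (-y) := by
  have h := Real.add_one_le_exp (y - 3 / 2)
  have e : Real.exp (-(3 / 2)) = Real.exp (y - 3 / 2) * Real.exp (-y) := by
    rw [← Real.exp_add]; congr 1; ring
  rw [e]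
  nlinarith [Real.exp_pos (-y)]

/-- Up to sign this is the slope of `exp(-v²/t)`, which is steepest at `v² = t/2`; the tangent bound
for `exp` used here is sharp at that point. -/
lemma abs_gaussian_slope_le {t : ℝ} (ht : 0 < t) (v : ℝ) :
    |2 * v / t * Real.exp (-v ^ 2 / t)| ≤ Real.sqrt (2 / (t * Real.exp 1)) := by
  refine Real.abs_le_sqrt ?_
  have h := Real.add_one_le_exp (2 * (v ^ 2 / t) - 1)
  have e : Real.exp (2 * (v ^ 2 / t) - 1) = (Real.exp (-v ^ 2 / t) ^ 2 * Real.exp 1)⁻¹ := by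
    rw [← Real.exp_nat_mul, ← Real.exp_add, ← Real.exp_neg]; congr 1; push_cast; ring
  rw [e, sub_add_cancel] at h
  have hE := Real.exp_pos (-v ^ 2 / t)
  have h2 := mul_le_mul_of_nonneg_right h (by positivity :
    0 ≤ 2 / t * Real.exp (-v ^ 2 / t) ^ 2)
  calc _ = 2 * (v ^ 2 / t) * (2 / t * Real.exp (-v ^ 2 / t) ^ 2) := by ring
    _ ≤ _ := h2
    _ = _ := by field_simp

lemma cubic_sub_le_gaussian_sub {t a b : ℝ} (ht : 0 < t) (hab : a ≤ b) :
    (b - a) - (b ^ 3 - a ^ 3) / t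
      ≤ b * Real.exp (-b ^ 2 / t) - a * Real.exp (-a ^ 2 / t) := by
  have hd : ∀ v : ℝ, HasDerivAt (fun v : ℝ => v * Real.exp (-v ^ 2 / t) - v + v ^ 3 / t)
      ((1 - 2 * (v ^ 2 / t)) * Real.exp (-(v ^ 2 / t)) - (1 - 3 * (v ^ 2 / t))) v := by
    intro v
    have h1 : HasDerivAt (fun v : ℝ => Real.exp (-v ^ 2 / t))
        (Real.exp (-v ^ 2 / t) * (-(2 * v) / t)) v := by
      simpa using (((hasDerivAt_pow 2 v).neg).div_const t).exp
    have h2 := (((hasDerivAt_id v).mul h1).sub (hasDerivAt_id v)).add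
      ((hasDerivAt_pow 3 v).div_const t)
    refine h2.congr_deriv ?_
    rw [← neg_div]
    simp only [id]
    push_cast
    ring
  have hm : Monotone (fun v : ℝ => v * Real.exp (-v ^ 2 / t) - v + v ^ 3 / t) := by
    refine monotone_of_deriv_nonneg (fun v => (hd v).differentiableAt) fun v => ?_
    rw [(hd v).deriv]
    exact sub_nonneg.2 (one_sub_three_mul_le (by positivity))
  have := hm hab
  simp only at this
  rw [sub_div]
  linarith

lemma abs_exp_neg_sub_le {x y m : ℝ} (hx : m ≤ x) (hy : m ≤ y) :
    |Real.exp (-y) - Real.exp (-x)| ≤ |y - x| * Real.exp (-m) := by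
  have main : ∀ {x y : ℝ}, m ≤ x → x ≤ y →
      |Real.exp (-y) - Real.exp (-x)| ≤ |y - x| * Real.exp (-m) := by
    intro x y hx hxy
    have h1 : Real.exp (-y) ≤ Real.exp (-x) := Real.exp_le_exp.2 (by linarith)
    have h2 : Real.exp (-x) ≤ Real.exp (-m) := Real.exp_le_exp.2 (by linarith)
    have h3 := Real.add_one_le_exp (-(y - x))
    have e : Real.exp (-y) = Real.exp (-x) * Real.exp (-(y - x)) := by
      rw [← Real.exp_add]; congr 1; ring
    rw [abs_sub_comm, abs_of_nonneg (sub_nonneg.2 h1), abs_of_nonneg (sub_nonneg.2 hxy)]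
    have h4 := mul_le_mul_of_nonneg_left h2 (sub_nonneg.2 hxy)
    have h5 := mul_le_mul_of_nonneg_left h3 (Real.exp_pos (-x)).le
    rw [e]
    linarith
  rcases le_total x y with h | h
  · exact main hx h
  · rw [abs_sub_comm, abs_sub_comm y]
    exact main hy h

/-- The test function `u ↦ (u - α₁) exp(-(u - α₂)² / t)` for Stein's equation. -/
noncomputable def steinFun (t α₁ α₂ u : ℝ) : ℝ := (u - α₁) * Real.exp (-(u - α₂) ^ 2 / t)

/-- Split `u - α₁ = (u - α₂) + (α₂ - α₁)`. The first part is handled by `cubic_sub_le_gaussian_sub`,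
the second by a Lipschitz bound for `exp`. As both points are at least 1, their exponents are
bounded by the one with `(1 - α₂)₊`. -/
lemma steinFun_sub_ge {t : ℝ} (ht : 0 < t) (α₁ α₂ : ℝ) (k : ℕ) :
    1 - ((k + 2 - α₂) ^ 3 - (k + 1 - α₂) ^ 3) / t
        - |α₁ - α₂| * ((2 * k + |3 - 2 * α₂|) / t * Real.exp (-(max (1 - α₂) 0) ^ 2 / t))
      ≤ steinFun t α₁ α₂ (k + 2) - steinFun t α₁ α₂ (k + 1) := by
  have hk : (0 : ℝ) ≤ k := Nat.cast_nonneg k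
  have h1 := cubic_sub_le_gaussian_sub ht (by linarith : (k : ℝ) + 1 - α₂ ≤ k + 2 - α₂)
  have hmin : ∀ c : ℝ, 1 ≤ c → (max (1 - α₂) 0) ^ 2 / t ≤ (k + c - α₂) ^ 2 / t := by
    intro c hc
    refine div_le_div_of_nonneg_right ?_ ht.le
    rcases le_total (1 - α₂) 0 with h | h
    · rw [max_eq_right h, zero_pow two_ne_zero]; positivity
    · rw [max_eq_left h]
      exact pow_le_pow_left₀ h (by linarith) 2
  have h2 := abs_exp_neg_sub_le (hmin 1 le_rfl) (hmin 2 (by norm_num))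
  have h3 : |(k + 2 - α₂) ^ 2 / t - (k + 1 - α₂) ^ 2 / t| ≤ (2 * k + |3 - 2 * α₂|) / t := by
    rw [← sub_div, abs_div, abs_of_pos ht]
    refine div_le_div_of_nonneg_right ?_ ht.le
    have : (k + 2 - α₂) ^ 2 - (k + 1 - α₂) ^ 2 = 2 * k + (3 - 2 * α₂) := by ring
    rw [this]
    refine (abs_add_le _ _).trans_eq ?_
    rw [abs_of_nonneg (by positivity)]
  have h4 := h2.trans (mul_le_mul_of_nonneg_right h3 (Real.exp_pos _).le)
  have h5 := mul_le_mul_of_nonneg_left h4 (abs_nonneg (α₁ - α₂))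
  rw [← abs_mul] at h5
  have h6 := (abs_le.1 h5).2
  simp only [← neg_div] at h1 h6
  simp only [steinFun]
  linarith

lemma hasDerivAt_steinFun {t : ℝ} (α₁ α₂ u : ℝ) :
    HasDerivAt (steinFun t α₁ α₂)
      ((1 - 2 * ((u - α₂) ^ 2 / t)) * Real.exp (-((u - α₂) ^ 2 / t))
        + (α₁ - α₂) * (2 * (u - α₂) / t * Real.exp (-(u - α₂) ^ 2 / t))) u := by
  have h0 : HasDerivAt (fun u : ℝ => u - α₂) 1 u := (hasDerivAt_id u).sub_const α₂
  have h1 : HasDerivAt (fun u : ℝ => Real.exp (-(u - α₂) ^ 2 / t))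
      (Real.exp (-(u - α₂) ^ 2 / t) * (-(2 * (u - α₂)) / t)) u := by
    simpa using (((h0.pow 2).neg).div_const t).exp
  have h2 := ((hasDerivAt_id u).sub_const α₁).mul h1
  refine h2.congr_deriv ?_
  rw [← neg_div]
  simp only [id]
  ring

lemma exists_steinFun_sub_eq {t : ℝ} (α₁ α₂ a : ℝ) :
    ∃ v, steinFun t α₁ α₂ (a + 1) - steinFun t α₁ α₂ a
      = (1 - 2 * (v ^ 2 / t)) * Real.exp (-(v ^ 2 / t))
        + (α₁ - α₂) * (2 * v / t * Real.exp (-v ^ 2 / t)) := by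
  obtain ⟨c, -, hc⟩ := exists_hasDerivAt_eq_slope (steinFun t α₁ α₂) _ (lt_add_one a)
    (fun x _ => (hasDerivAt_steinFun α₁ α₂ x).continuousAt.continuousWithinAt)
    (fun x _ => hasDerivAt_steinFun α₁ α₂ x)
  refine ⟨c - α₂, ?_⟩
  rw [hc]
  simp

lemma steinFun_sub_le {t : ℝ} (ht : 0 < t) (α₁ α₂ a : ℝ) :
    steinFun t α₁ α₂ (a + 1) - steinFun t α₁ α₂ a
      ≤ 1 + Real.sqrt (2 / (t * Real.exp 1)) * |α₁ - α₂| := by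
  obtain ⟨v, hv⟩ := exists_steinFun_sub_eq (t := t) α₁ α₂ a
  rw [hv, mul_comm (Real.sqrt _)]
  refine add_le_add (one_sub_two_mul_exp_le (by positivity)) ?_
  refine (le_abs_self _).trans ?_
  rw [abs_mul]
  exact mul_le_mul_of_nonneg_left (abs_gaussian_slope_le ht v) (abs_nonneg _)

lemma neg_steinFun_sub_le {t : ℝ} (ht : 0 < t) (α₁ α₂ a : ℝ) :
    -(steinFun t α₁ α₂ (a + 1) - steinFun t α₁ α₂ a)
      ≤ 2 * Real.exp (-(3 / 2)) + Real.sqrt (2 / (t * Real.exp 1)) * |α₁ - α₂| := by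
  obtain ⟨v, hv⟩ := exists_steinFun_sub_eq (t := t) α₁ α₂ a
  rw [hv, mul_comm (Real.sqrt _), neg_add]
  refine add_le_add (by linarith [neg_two_exp_le (v ^ 2 / t)]) ?_
  refine (neg_le_abs _).trans ?_
  rw [abs_mul]
  exact mul_le_mul_of_nonneg_left (abs_gaussian_slope_le ht v) (abs_nonneg _)

lemma abs_steinFun_le {t : ℝ} (ht : 0 < t) (α₁ α₂ u : ℝ) :
    |steinFun t α₁ α₂ u| ≤ 1 + t + |α₂ - α₁| := by
  set v := u - α₂ with hv
  have hE := Real.exp_pos (-v ^ 2 / t)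
  have hE1 : Real.exp (-v ^ 2 / t) ≤ 1 := Real.exp_le_one_iff.2 (by
    rw [neg_div]; exact neg_nonpos.2 (by positivity))
  have h := Real.add_one_le_exp (v ^ 2 / t)
  have e : Real.exp (v ^ 2 / t) * Real.exp (-v ^ 2 / t) = 1 := by
    rw [← Real.exp_add, neg_div, add_neg_cancel, Real.exp_zero]
  have h2 : v ^ 2 * Real.exp (-v ^ 2 / t) ≤ t := by
    have h3 := mul_le_mul_of_nonneg_right h hE.le
    rw [e] at h3
    have h4 := mul_le_mul_of_nonneg_left h3 ht.le
    have h5 : t * ((v ^ 2 / t + 1) * Real.exp (-v ^ 2 / t))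
        = v ^ 2 * Real.exp (-v ^ 2 / t) + t * Real.exp (-v ^ 2 / t) := by field_simp
    rw [h5] at h4
    linarith [mul_pos ht hE]
  have hu : u - α₁ = v + (α₂ - α₁) := by rw [hv]; ring
  rw [steinFun, ← hv, hu, abs_mul, abs_of_pos hE]
  have h6 : |v| ≤ 1 + v ^ 2 := by rw [← sq_abs v]; nlinarith [sq_nonneg (|v| - 1), abs_nonneg v]
  have h7 := mul_le_mul_of_nonneg_right ((abs_add_le v (α₂ - α₁)).trans
    (add_le_add_left h6 _)) hE.le
  nlinarith [abs_nonneg (α₂ - α₁)]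

end SteinFunction

/-! ### Extrema of `xFun` and the bound on the Stein operator. -/

section Extrema

open Filter Topology

lemma exists_forall_le_of_tendsto_zero {f : ℝ → ℝ} (hc : Continuous f)
    (ht : Tendsto f (cocompact ℝ) (𝓝 0)) {u₀ : ℝ} (h0 : f u₀ = 0) : ∃ m, ∀ u, f u ≤ f m := by
  by_cases h : ∃ u, 0 < f u
  · obtain ⟨u, hu⟩ := h
    exact hc.exists_forall_ge' u ((ht.eventually_lt_const hu).mono fun x hx => hx.le)
  · push Not at h
    exact ⟨u₀, fun u => h0 ▸ h u⟩

lemma continuous_xFun (l α₁ α₂ θ : ℝ) : Continuous (xFun l α₁ α₂ θ) := by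
  unfold xFun
  fun_prop

lemma tendsto_xFun (l α₁ α₂ θ : ℝ) : Tendsto (xFun l α₁ α₂ θ) (cocompact ℝ) (𝓝 0) := by
  have h : ∀ n : ℕ, Tendsto (fun u : ℝ => u ^ n * Real.exp (-u ^ 2)) (cocompact ℝ) (𝓝 0) := by
    intro n
    rw [tendsto_zero_iff_norm_tendsto_zero]
    refine (tendsto_rpow_abs_mul_exp_neg_mul_sq_cocompact one_pos n).congr fun u => ?_
    rw [Real.rpow_natCast, norm_mul, norm_pow, Real.norm_eq_abs, Real.norm_eq_abs, Real.abs_exp]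
    simp
  have := (((h 0).const_mul (coeff0 l α₁ α₂)).add ((h 1).const_mul (coeff1 l α₁ α₂ θ))).add
    ((h 2).const_mul (coeff2 l θ))
  simp only [mul_zero, add_zero] at this
  refine this.congr fun u => ?_
  rw [xFun]
  ring

lemma hasDerivAt_xFun (l α₁ α₂ θ u : ℝ) :
    HasDerivAt (xFun l α₁ α₂ θ)
      (-(2 * coeff2 l θ * u ^ 3 + 2 * coeff1 l α₁ α₂ θ * u ^ 2
        - 2 * (coeff2 l θ - coeff0 l α₁ α₂) * u - coeff1 l α₁ α₂ θ) * Real.exp (-u ^ 2)) u := by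
  have h1 : HasDerivAt (fun u : ℝ => Real.exp (-u ^ 2)) (Real.exp (-u ^ 2) * (-(2 * u))) u := by
    simpa using ((hasDerivAt_pow 2 u).neg).exp
  have h2 := ((((hasDerivAt_id u).const_mul (coeff1 l α₁ α₂ θ)).const_add (coeff0 l α₁ α₂)).add
    ((hasDerivAt_pow 2 u).const_mul (coeff2 l θ))).mul h1
  refine h2.congr_deriv ?_
  simp only [id, Pi.add_apply]
  push_cast
  ring

lemma mem_cubicZeros_of_isLocalExtr {l α₁ α₂ θ u : ℝ} (h : IsLocalExtr (xFun l α₁ α₂ θ) u) :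
    u ∈ cubicZeros l α₁ α₂ θ := by
  have := h.hasDerivAt_eq_zero (hasDerivAt_xFun l α₁ α₂ θ u)
  exact neg_eq_zero.1 ((mul_eq_zero.1 this).resolve_right (Real.exp_pos _).ne')

/-- This explains the coefficients `c₀, c₁, c₂`: they expand `(l - k)(k - α₁)` in the variable `u =
(k - α₂)/√(θl)`. -/
lemma xFun_scaled {l θ : ℝ} (ht : 0 < θ * l) (α₁ α₂ k : ℝ) :
    xFun l α₁ α₂ θ ((k - α₂) / Real.sqrt (θ * l)) = (l - k) * steinFun (θ * l) α₁ α₂ k := by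
  have hs := Real.sq_sqrt ht.le
  have hs0 := Real.sqrt_pos.2 ht
  rw [xFun, steinFun, coeff0, coeff1, coeff2, div_pow, hs, neg_div, ← mul_assoc]
  congr 1
  have e1 : Real.sqrt (θ * l) * (l + α₁ - 2 * α₂) * ((k - α₂) / Real.sqrt (θ * l))
      = (l + α₁ - 2 * α₂) * (k - α₂) := by field_simp
  have e2 : -(θ * l) * ((k - α₂) ^ 2 / (θ * l)) = -(k - α₂) ^ 2 := by
    rw [neg_mul, mul_div_cancel₀ _ ht.ne']
  rw [e1, e2]
  ring

lemma exists_xFun_eq_zero {l θ : ℝ} (ht : 0 < θ * l) (α₁ α₂ : ℝ) :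
    ∃ u, xFun l α₁ α₂ θ u = 0 :=
  ⟨_, by rw [xFun_scaled ht α₁ α₂ l, sub_self, zero_mul]⟩

/-- `xFun` is continuous, tends to 0 at infinity and has a zero, so it attains a global maximum.
That point is critical, hence a root of the cubic. -/
lemma xFun_le_maxX {l θ : ℝ} (ht : 0 < θ * l) (α₁ α₂ u : ℝ) :
    xFun l α₁ α₂ θ u ≤ maxX l α₁ α₂ θ := by
  obtain ⟨u₀, h0⟩ := exists_xFun_eq_zero ht α₁ α₂
  obtain ⟨m, hm⟩ := exists_forall_le_of_tendsto_zero (continuous_xFun l α₁ α₂ θ)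
    (tendsto_xFun l α₁ α₂ θ) h0
  refine (hm u).trans (le_csSup ⟨xFun l α₁ α₂ θ m, ?_⟩ ⟨m, ?_, rfl⟩)
  · rintro _ ⟨v, -, rfl⟩
    exact hm v
  · exact mem_cubicZeros_of_isLocalExtr (Or.inr (Eventually.of_forall hm))

lemma minX_le_xFun {l θ : ℝ} (ht : 0 < θ * l) (α₁ α₂ u : ℝ) :
    minX l α₁ α₂ θ ≤ xFun l α₁ α₂ θ u := by
  obtain ⟨u₀, h0⟩ := exists_xFun_eq_zero ht α₁ α₂
  obtain ⟨m, hm⟩ := exists_forall_le_of_tendsto_zero (continuous_xFun l α₁ α₂ θ).neg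
    (neg_zero (G := ℝ) ▸ (tendsto_xFun l α₁ α₂ θ).neg) (u₀ := u₀) (by simp [h0])
  replace hm : ∀ v, xFun l α₁ α₂ θ m ≤ xFun l α₁ α₂ θ v := fun v => neg_le_neg_iff.1 (hm v)
  refine le_trans (csInf_le ⟨xFun l α₁ α₂ θ m, ?_⟩
    (Set.mem_image_of_mem (xFun l α₁ α₂ θ) (x := m) ?_)) (hm u)
  · rintro _ ⟨v, -, rfl⟩
    exact hm v
  · exact mem_cubicZeros_of_isLocalExtr (Or.inl (Eventually.of_forall hm))

/-- Write `l f(a+1) - a f(a) = l (f(a+1) - f(a)) + (l - a) f(a)`; the last term is a value of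
`xFun`. -/
lemma abs_stein_operator_le {l θ : ℝ} (hl : 0 < l) (hθ : 0 < θ) (α₁ α₂ a : ℝ) :
    |l * steinFun (θ * l) α₁ α₂ (a + 1) - a * steinFun (θ * l) α₁ α₂ a| ≤ gFun l α₁ α₂ θ := by
  have ht := mul_pos hθ hl
  have h1 := mul_le_mul_of_nonneg_right (steinFun_sub_le ht α₁ α₂ a) hl.le
  have h2 := mul_le_mul_of_nonneg_right (neg_steinFun_sub_le ht α₁ α₂ a) hl.le
  have h3 := xFun_le_maxX ht α₁ α₂ ((a - α₂) / Real.sqrt (θ * l))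
  have h4 := minX_le_xFun ht α₁ α₂ ((a - α₂) / Real.sqrt (θ * l))
  rw [xFun_scaled ht] at h3 h4
  refine abs_le'.2 ⟨le_max_of_le_left (le_trans ?_ (le_abs_self _)),
    le_max_of_le_right (le_trans ?_ (le_abs_self _))⟩ <;> linarith

end Extrema

/-! ### Stein's identity under the Poisson law. -/

section SteinPoisson

open Filter Topology

/-- Stein's identity for the Poisson distribution. -/
lemma hasSum_poisson_stein {l : ℝ} (hl : 0 < l) {f : ℕ → ℝ} {A B : ℝ} (hf : ∀ k, |f k| ≤ A)
    (hb : ∀ k : ℕ, |l * f (k + 1) - k * f k| ≤ B)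
    (h1 : HasSum (fun k : ℕ => Real.exp (-l) * l ^ k / k.factorial) 1) :
    HasSum (fun k : ℕ => (l * f (k + 1) - k * f k) * (Real.exp (-l) * l ^ k / k.factorial)) 0 := by
  have hpos : ∀ k : ℕ, 0 < Real.exp (-l) * l ^ k / k.factorial := fun k => by positivity
  have hs : Summable
      (fun k : ℕ => (l * f (k + 1) - k * f k) * (Real.exp (-l) * l ^ k / k.factorial)) := by
    refine Summable.of_norm_bounded (h1.summable.mul_left B) fun k => ?_
    rw [norm_mul, Real.norm_eq_abs, Real.norm_eq_abs, abs_of_pos (hpos k)]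
    exact mul_le_mul_of_nonneg_right (hb k) (hpos k).le
  rw [hs.hasSum_iff_tendsto_nat, ← tendsto_add_atTop_iff_nat 1]
  -- The Poisson recursion makes the sum telescope; bounded `f` then kills the boundary term.
  have tel : ∀ N : ℕ, ∑ k ∈ Finset.range (N + 1),
      (l * f (k + 1) - k * f k) * (Real.exp (-l) * l ^ k / k.factorial)
        = l * f (N + 1) * (Real.exp (-l) * l ^ N / N.factorial) := by
    intro N
    induction N with
    | zero => simp
    | succ N ih =>
      rw [Finset.sum_range_succ, ih, Nat.factorial_succ]
      push_cast
      field_simp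
      ring
  simp only [tel]
  refine squeeze_zero_norm (a := fun N : ℕ => l * A * (Real.exp (-l) * l ^ N / N.factorial))
    (fun N => ?_) (by simpa using h1.summable.tendsto_atTop_zero.const_mul (l * A))
  rw [norm_mul, norm_mul, Real.norm_eq_abs, Real.norm_eq_abs, Real.norm_eq_abs,
    abs_of_pos (hpos N), abs_of_pos hl]
  exact mul_le_mul_of_nonneg_right (mul_le_mul_of_nonneg_left (hf _) hl.le) (hpos N).le

end SteinPoisson

/-! ### Chen–Stein lower bound for total variation. -/

section TotalVariation

variable {ι : Type*} [DecidableEq ι]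

lemma polyExp_quadratic (A B D : ℝ) (s : Finset ι) (p : ι → ℝ) :
    polyExp (fun k => A + B * k + D * (k : ℝ) ^ 2) (pbPoly s p)
      = A + B * ∑ i ∈ s, p i
        + D * ((∑ i ∈ s, p i) ^ 2 + ∑ i ∈ s, p i - ∑ i ∈ s, p i ^ 2) := by
  rw [polyExp_add, polyExp_add, polyExp_const_mul, polyExp_const_mul, polyExp_id, polyExp_sq,
    polyExp_const, pbPoly_eval_one, mul_one]

lemma one_sub_hFun_le_polyExp {l θ α₁ α₂ : ℝ} (hl : 0 < l) (hθ : 0 < θ) (hα : α₂ ≤ l + 3 / 2)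
    (s : Finset ι) {p : ι → ℝ} (h0 : ∀ i, 0 ≤ p i) (h1 : ∀ i, p i ≤ 1)
    (hsum : ∑ i ∈ s, p i = l) {i : ι} (hi : i ∈ s) :
    1 - hFun l α₁ α₂ θ ≤ polyExp (fun k => steinFun (θ * l) α₁ α₂ ((k + 2 : ℕ) : ℝ)
      - steinFun (θ * l) α₁ α₂ ((k + 1 : ℕ) : ℝ)) (pbPoly (s.erase i) p) := by
  have ht := mul_pos hθ hl
  set t := θ * l with htdef
  set E := |α₁ - α₂| * Real.exp (-(max (1 - α₂) 0) ^ 2 / t) with hE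
  have hE0 : 0 ≤ E := by positivity
  refine le_trans ?_ (polyExp_mono (pbPoly_coeff_nonneg (s.erase i) h0 h1)
    (F := fun k => (1 - (3 * (1 - α₂) ^ 2 + 3 * (1 - α₂) + 1) / t - E * |3 - 2 * α₂| / t)
      + (-(9 - 6 * α₂ + 2 * E) / t) * k + (-3 / t) * (k : ℝ) ^ 2) fun k => ?_)
  · rw [polyExp_quadratic]
    have hm : ∑ j ∈ s.erase i, p j = l - p i := by
      rw [← hsum, ← Finset.add_sum_erase s p hi]; ring
    have hS : 0 ≤ ∑ j ∈ s.erase i, p j ^ 2 := Finset.sum_nonneg fun j _ => sq_nonneg _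
    rw [hm]
    set S := ∑ j ∈ s.erase i, p j ^ 2
    have hh : hFun l α₁ α₂ θ = (3 * l + (2 - α₂ + l) ^ 3 - (1 - α₂ + l) ^ 3
        + E * (2 * l + |3 - 2 * α₂|)) / t := by
      rw [hFun, hE]; congr 1; ring
    rw [hh, ← sub_nonneg]
    have hp := h0 i
    have hp1 := h1 i
    -- This is the slack, times `t`, from replacing the moments of the sum without `Xᵢ` by `l` and
    -- `l² + l`. The condition `α₂ ≤ l + 3/2` keeps it nonnegative.
    have key : 0 ≤ 3 * (p i * (1 - p i + 2 * (l + 3 / 2 - α₂))) + 2 * (E * p i) + 3 * S := by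
      have : 0 ≤ p i * (1 - p i + 2 * (l + 3 / 2 - α₂)) := mul_nonneg hp (by linarith)
      have := mul_nonneg hE0 hp
      linarith
    have := div_nonneg key ht.le
    refine this.trans_eq ?_
    field_simp
    ring
  · refine le_trans (le_of_eq ?_) ((steinFun_sub_ge ht α₁ α₂ k).trans (le_of_eq ?_))
    · rw [hE]
      field_simp
      ring
    · push_cast
      rfl

/-- The Chen–Stein lower bound for the total variation distance. -/
lemma mul_sum_sq_le_tsum_abs {l r : ℝ} (hl : 0 < l) (hr : r ∈ K1Values l) (s : Finset ι)
    {p : ι → ℝ} (h0 : ∀ i, 0 ≤ p i) (h1 : ∀ i, p i ≤ 1) (hsum : ∑ i ∈ s, p i = l)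
    (hPs : HasSum (fun k => (pbPoly s p).coeff k) 1)
    (hQs : HasSum (fun k : ℕ => Real.exp (-l) * l ^ k / k.factorial) 1) :
    r * ∑ i ∈ s, p i ^ 2
      ≤ 1 / 2 * ∑' k : ℕ, |(pbPoly s p).coeff k - Real.exp (-l) * l ^ k / k.factorial| := by
  obtain ⟨α₁, α₂, θ, hα, hθ, rfl⟩ := hr
  have ht := mul_pos hθ hl
  set g := gFun l α₁ α₂ θ with hg
  have habs := summable_abs_sub hPs hQs
  have hD : 0 ≤ ∑' k : ℕ, |(pbPoly s p).coeff k - Real.exp (-l) * l ^ k / k.factorial| :=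
    tsum_nonneg fun k => abs_nonneg _
  have hg0 : 0 ≤ g := le_max_of_le_left (abs_nonneg _)
  -- If `g = 0`, the quotient is 0 by convention and the bound is trivial.
  rcases hg0.eq_or_lt with h | hgpos
  · rw [← h]
    simpa using hD
  set f : ℕ → ℝ := fun k => steinFun (θ * l) α₁ α₂ k with hf
  have hbound : ∀ k : ℕ, |l * f (k + 1) - k * f k| ≤ g := fun k => by
    have := abs_stein_operator_le hl hθ α₁ α₂ k
    simpa [hf] using this
  have e1 := hasSum_polyExp (fun k => l * f (k + 1) - k * f k) (pbPoly s p)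
  have e2 := hasSum_poisson_stein hl (fun k => abs_steinFun_le ht α₁ α₂ k) hbound hQs
  have e3 := e1.sub e2
  rw [sub_zero] at e3
  have up : polyExp (fun k => l * f (k + 1) - k * f k) (pbPoly s p)
      ≤ g * ∑' k : ℕ, |(pbPoly s p).coeff k - Real.exp (-l) * l ^ k / k.factorial| := by
    refine hasSum_le (fun k => ?_) e3 (habs.hasSum.mul_left g)
    rw [← mul_sub]
    refine (le_abs_self _).trans ?_
    rw [abs_mul]
    exact mul_le_mul_of_nonneg_right (hbound k) (abs_nonneg _)
  have low : (1 - hFun l α₁ α₂ θ) * ∑ i ∈ s, p i ^ 2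
      ≤ polyExp (fun k => l * f (k + 1) - k * f k) (pbPoly s p) := by
    have := polyExp_chenStein f s p
    rw [hsum] at this
    rw [this, Finset.mul_sum]
    refine Finset.sum_le_sum fun i hi => ?_
    rw [mul_comm]
    exact mul_le_mul_of_nonneg_left (one_sub_hFun_le_polyExp hl hθ hα s h0 h1 hsum hi)
      (sq_nonneg _)
  rw [div_mul_eq_mul_div, div_le_iff₀ (by positivity)]
  linarith [low.trans up]

/-- Ensures `0 ≤ K1 l`, so that the total variation bound may be squared. With `α₁ = α₂ = l` one has
`h = (3l + 7)/(θl)`, and `θ` is chosen to make this 1. -/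
lemma zero_mem_K1Values {l : ℝ} (hl : 0 < l) : 0 ∈ K1Values l := by
  refine ⟨l, l, (3 * l + 7) / l, by linarith, by positivity, ?_⟩
  have : hFun l l l ((3 * l + 7) / l) = 1 := by
    rw [hFun, div_mul_cancel₀ _ hl.ne', div_eq_one_iff_eq (by positivity)]
    simp
    ring
  rw [this, sub_self, zero_div]

end TotalVariation

/-! ### Bernoulli variables and the final assembly. -/

lemma measureReal_eq_one_of_bernoulli {Ω : Type*} [MeasurableSpace Ω] {μ : Measure Ω} {Y : Ω → ℕ}
    (hY : Measurable Y) (hb : ∀ᵐ ω ∂μ, Y ω = 0 ∨ Y ω = 1) :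
    μ.real {ω | Y ω = 1} = ∫ ω, (Y ω : ℝ) ∂μ := by
  have hm : MeasurableSet {ω | Y ω = 1} := measurableSet_eq_fun hY measurable_const
  rw [← integral_indicator_one hm]
  refine integral_congr_ae ?_
  filter_upwards [hb] with ω hω
  rcases hω with h | h <;> simp [Set.indicator, h]

lemma measureReal_eq_zero_of_bernoulli {Ω : Type*} [MeasurableSpace Ω] {μ : Measure Ω}
    [IsProbabilityMeasure μ] {Y : Ω → ℕ} (hY : Measurable Y)
    (hb : ∀ᵐ ω ∂μ, Y ω = 0 ∨ Y ω = 1) :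
    μ.real {ω | Y ω = 0} = 1 - ∫ ω, (Y ω : ℝ) ∂μ := by
  have hm : MeasurableSet {ω | Y ω = 1} := measurableSet_eq_fun hY measurable_const
  rw [← measureReal_eq_one_of_bernoulli hY hb, ← probReal_compl_eq_one_sub hm]
  refine measureReal_congr ?_
  filter_upwards [hb] with ω hω
  apply propext
  change Y ω = 0 ↔ ¬ Y ω = 1
  omega

lemma integrable_of_bernoulli {Ω : Type*} [MeasurableSpace Ω] {μ : Measure Ω}
    [IsProbabilityMeasure μ] {Y : Ω → ℕ} (hY : Measurable Y)
    (hb : ∀ᵐ ω ∂μ, Y ω = 0 ∨ Y ω = 1) : Integrable (fun ω => (Y ω : ℝ)) μ := by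
  refine Integrable.of_bound (measurable_from_nat.comp hY).aestronglyMeasurable 1 ?_
  filter_upwards [hb] with ω hω
  rcases hω with h | h <;> simp [h]

theorem corollary3 {Ω : Type*} [MeasurableSpace Ω] (μ : Measure Ω) [IsProbabilityMeasure μ]
    (n : ℕ) (X : Fin n → Ω → ℕ) (p : Fin n → ℝ) (W : Ω → ℕ) (l : ℝ≥0)
    (hmeas : ∀ i, Measurable (X i))
    (hbern : ∀ i, ∀ᵐ ω ∂μ, X i ω = 0 ∨ X i ω = 1)
    (hindep : iIndepFun X μ)
    (hp : ∀ i, ∫ ω, (X i ω : ℝ) ∂μ = p i)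
    (hW : ∀ ω, W ω = ∑ i, X i ω)
    (hl : ∫ ω, (W ω : ℝ) ∂μ = (l : ℝ))
    (hlpos : 0 < l) :
    BddAbove (K1Values l) ∧
    Real.sqrt (1 - Real.sqrt (1 - (K1 l) ^ 2 * (∑ i, (p i) ^ 2) ^ 2))
      ≤ hellingerDist (μ.map W) (poissonMeasure l) ∧
    bhattacharyya (μ.map W) (poissonMeasure l)
      ≤ Real.sqrt (1 - (K1 l) ^ 2 * (∑ i, (p i) ^ 2) ^ 2) ∧
    ((∀ i, p i < 1) →
      hellingerDist (μ.map W) (poissonMeasure l)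
        ≤ Real.sqrt (1 - Real.exp (-(1 / (2 * (l : ℝ))) * ∑ i, (p i) ^ 3 / (1 - p i))) ∧
      Real.exp (-(1 / (2 * (l : ℝ))) * ∑ i, (p i) ^ 3 / (1 - p i))
        ≤ bhattacharyya (μ.map W) (poissonMeasure l)) := by
  have hl0 : (0 : ℝ) < l := hlpos
  have hone : ∀ i, μ.real {ω | X i ω = 1} = p i := fun i => by
    rw [measureReal_eq_one_of_bernoulli (hmeas i) (hbern i), hp]
  have hzero : ∀ i, μ.real {ω | X i ω = 0} = 1 - p i := fun i => by
    rw [measureReal_eq_zero_of_bernoulli (hmeas i) (hbern i), hp]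
  have h0 : ∀ i, 0 ≤ p i := fun i => hone i ▸ measureReal_nonneg
  have h1 : ∀ i, p i ≤ 1 := fun i => hone i ▸ measureReal_le_one
  have hsum : ∑ i, p i = (l : ℝ) := by
    rw [← hl]
    simp only [hW, Nat.cast_sum]
    rw [integral_finsetSum _ fun i _ => integrable_of_bernoulli (hmeas i) (hbern i)]
    exact Finset.sum_congr rfl fun i _ => (hp i).symm
  have hWm : Measurable W := by
    rw [funext hW]
    exact Finset.measurable_fun_sum _ fun i _ => hmeas i
  have hPW : ∀ k, (μ.map W).real {k} = (pbPoly Finset.univ p).coeff k := fun k => by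
    rw [map_measureReal_apply hWm (measurableSet_singleton k),
      ← measureReal_sum_eq_coeff_pbPoly hmeas hindep hzero hone hbern Finset.univ k]
    congr 1
    ext ω
    simp [hW]
  have hQW : ∀ k : ℕ, (poissonMeasure l).real {k} = Real.exp (-l) * l ^ k / k.factorial :=
    poissonMeasure_real_singleton l
  have hPs : HasSum (fun k => (pbPoly Finset.univ p).coeff k) 1 := by
    have := hasSum_polyExp (fun _ => 1) (pbPoly Finset.univ p)
    simpa [polyExp_const, pbPoly_eval_one] using this
  have hQs := hasSum_one_poissonMeasure l
  have hP0 := pbPoly_coeff_nonneg Finset.univ h0 h1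
  have hQ0 : ∀ k : ℕ, 0 ≤ Real.exp (-l) * (l : ℝ) ^ k / k.factorial := fun k => by positivity
  have hH : hellingerDist (μ.map W) (poissonMeasure l)
      = Real.sqrt (1 - bhattacharyya (μ.map W) (poissonMeasure l)) := by
    simp only [hellingerDist, bhattacharyya, hPW, hQW]
    rw [tsum_sqrt_sub_sqrt_sq hP0 hQ0 hPs hQs]
  have hBC : bhattacharyya (μ.map W) (poissonMeasure l) = ∑' k : ℕ,
      Real.sqrt ((pbPoly Finset.univ p).coeff k * (Real.exp (-l) * l ^ k / k.factorial)) := by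
    simp only [bhattacharyya, hPW, hQW]
  have hB0 : 0 ≤ bhattacharyya (μ.map W) (poissonMeasure l) :=
    tsum_nonneg fun k => Real.sqrt_nonneg _
  have hTV := sq_tsum_abs_sub_le hP0 hQ0 hPs hQs
  rw [← hBC] at hTV
  have hS : 0 < ∑ i, p i ^ 2 := by
    refine (Finset.sum_nonneg fun i _ => sq_nonneg (p i)).lt_of_ne' fun h => hl0.ne' ?_
    rw [Finset.sum_eq_zero_iff_of_nonneg fun i _ => sq_nonneg _] at h
    rw [← hsum]
    exact Finset.sum_eq_zero fun i hi => pow_eq_zero_iff two_ne_zero |>.1 (h i hi)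
  have hK : ∀ r ∈ K1Values l, r ≤ (1 / 2 * ∑' k : ℕ, |(pbPoly Finset.univ p).coeff k
      - Real.exp (-l) * l ^ k / k.factorial|) / ∑ i, p i ^ 2 := fun r hr =>
    (le_div_iff₀ hS).2 (mul_sum_sq_le_tsum_abs hl0 hr Finset.univ h0 h1 hsum hPs hQs)
  have hbdd : BddAbove (K1Values l) := ⟨_, hK⟩
  have hK0 : 0 ≤ K1 l := le_csSup hbdd (zero_mem_K1Values hl0)
  have hK1 := (le_div_iff₀ hS).1 (csSup_le ⟨0, zero_mem_K1Values hl0⟩ hK)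
  have hK2 := pow_le_pow_left₀ (mul_nonneg hK0 hS.le) hK1 2
  rw [mul_pow] at hK2
  have hle : bhattacharyya (μ.map W) (poissonMeasure l)
      ≤ Real.sqrt (1 - (K1 l) ^ 2 * (∑ i, (p i) ^ 2) ^ 2) :=
    Real.le_sqrt_of_sq_le (by linarith [hK2.trans hTV])
  refine ⟨hbdd, ?_, hle, fun hlt => ?_⟩
  · rw [hH]
    exact Real.sqrt_le_sqrt (by linarith)
  · have hge : Real.exp (-(1 / (2 * (l : ℝ))) * ∑ i, (p i) ^ 3 / (1 - p i))
        ≤ bhattacharyya (μ.map W) (poissonMeasure l) := by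
      rw [hBC]
      exact (pbPoly_bhattacharyya_ge Finset.univ hl0 hsum h0 hlt).trans
        ((summable_sqrt_mul hP0 hQ0 hPs hQs).sum_le_tsum _ fun k _ => Real.sqrt_nonneg _)
    refine ⟨?_, hge⟩
    rw [hH]
    exact Real.sqrt_le_sqrt (by linarith)
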